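/- For a finite group $G$, let $\mathrm{Irr}(G)$ be the set of irreducible complex characters of $G$, let $\mathrm{Cl}(G)$ be the set of conjugacy classes of $G$, and let $g^G$ be the conjugacy class of $g\in G$. Put $$\theta(G)=\min_{\chi\in \mathrm{Irr}(G)}\frac{|\{g\in G : \chi(g)\text{ is a root of unity or zero}\}|}{|G|}$$ and $$\theta'(G)=\min_{g\in G,\ |g^G|\geq |G|/|\mathrm{Cl}(G)|}\frac{|\{\chi\in\mathrm{Irr}(G) : \chi(g)\text{ is a root of unity or zero}\}|}{|\mathrm{Irr}(G)|}.$$ (Both minima exist for every finite group $G$.) **Theorem.** If $G$ is a finite nilpotent group, then $\theta(G)>\tfrac12$ and $\theta'(G)>\tfrac12$. Equivalently: for each $\chi\in\mathrm{Irr}(G)$, $\chi(g)$ is a root of unity or zero for more than half of the elements $g\in G$; and for each $g\in G$ with $|g^G|\geq |G|/|\mathrm{Cl}(G)|$, $\chi(g)$ is a root of unity or zero for more than half of the characters $\chi\in\mathrm{Irr}(G)$. -/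

import Mathlib

/-- `Irr G`: the set of irreducible complex characters of `G`, i.e. the trace functions of the
irreducible representations of `G` on the spaces `ℂ ^ n`. -/
def Irr (G : Type*) [Group G] : Set (G → ℂ) :=
  {χ | ∃ (n : ℕ) (ρ : Representation ℂ G (Fin n → ℂ)), ρ.IsIrreducible ∧ ρ.character = χ}

/-- `z` is a root of unity or zero. -/
def IsRootOfUnityOrZero (z : ℂ) : Prop :=
  (∃ n : ℕ, 0 < n ∧ z ^ n = 1) ∨ z = 0

/-- The proportion of the elements `g` of `G` for which `χ g` is a root of unity or zero. -/
noncomputable def rowProportion {G : Type*} [Group G] (χ : G → ℂ) : ℝ :=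
  ({g : G | IsRootOfUnityOrZero (χ g)}.ncard : ℝ) / (Nat.card G : ℝ)

/-- The proportion of the irreducible characters `χ` of `G` for which `χ g` is a root of unity
or zero. -/
noncomputable def columnProportion {G : Type*} [Group G] (g : G) : ℝ :=
  ({χ : G → ℂ | χ ∈ Irr G ∧ IsRootOfUnityOrZero (χ g)}.ncard : ℝ) / ((Irr G).ncard : ℝ)

/-- The conjugacy class of `g` has at least the average size `|G| / |Cl(G)|`. -/
def HasAtLeastAverageClass {G : Type*} [Group G] (g : G) : Prop :=
  (Nat.card G : ℝ) / (Nat.card (ConjClasses G) : ℝ) ≤ ((conjugatesOf g).ncard : ℝ)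

/-- The set of numbers of which `θ(G)` is the minimum. -/
def rowProportions (G : Type*) [Group G] : Set ℝ :=
  {r | ∃ χ ∈ Irr G, rowProportion χ = r}

/-- The set of numbers of which `θ'(G)` is the minimum. -/
def columnProportions (G : Type*) [Group G] : Set ℝ :=
  {r | ∃ g : G, HasAtLeastAverageClass g ∧ columnProportion g = r}

/-- `θ(G)`, the minimum of the row proportions over the irreducible characters of `G`. -/
noncomputable def theta (G : Type*) [Group G] : ℝ := sInf (rowProportions G)

/-- `θ'(G)`, the minimum of the column proportions over the elements of `G` whose class has at
least the average size. -/
noncomputable def theta' (G : Type*) [Group G] : ℝ := sInf (columnProportions G)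

/-! Linear characters take only roots of unity as values, so only nonlinear irreducible characters
`χ`, afforded by `ρ`, matter. Nilpotency gives an element `z` with `ρ z` not scalar but commuting up
to scalars with every `ρ t`.

Rows: taking traces, `χ` vanishes off the proper subgroup of those `t` with `ρ t` commuting with `ρ
z`. It also vanishes at `z`, inside this subgroup, so its support has fewer than `|G| / 2` elements
(`two_mul_ncard_support_lt`).

Columns: the key is that if `χ g ≠ 0`, then `‖χ (g ^ m)‖ ^ 2` has mean at least 2 over `m` coprime
to `|G|` (`two_mul_totient_le_sum_norm_character_sq`). A commutator scalar of prime order `p` forces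
`p` to divide the dimensions of the eigenspaces of the `p'`-part of `g`. Hence `χ g = ∑ ζ ^ j * b j`
with `ζ` of `p`-power order, `b j` in a cyclotomic ring `ℤ[η]` of order prime to `p`, and `∑ b j`
divisible by `p`. Nonzero elements of `ℤ[η]` have mean squared conjugate at least 1, by AM-GM and
integrality of the norm; Plancherel in `ζ` and the divisibility raise the bound to 2
(`two_mul_totient_mul_le_sum_norm_sq`).

If the class of `g` has at least average size, column orthogonality bounds the mean over all `χ` of
`‖χ (g ^ m)‖ ^ 2` by 1. Bad characters contribute at least 2 each on average over `m`, and the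
trivial one contributes 1, so fewer than half are bad. -/

open Finset in
theorem geom_sum_eq_zero_of_pow_eq_one {z : ℂ} {n : ℕ} (h : z ^ n = 1) (hz : z ≠ 1) :
    ∑ k ∈ range n, z ^ k = 0 := by
  have := mul_geom_sum z n
  rw [h, sub_self] at this
  exact (mul_eq_zero.1 this).resolve_left (sub_ne_zero.2 hz)

/-! ### Spectral projections of operators of finite order -/

section Projections

variable {A : Type*} [Ring A] [Algebra ℂ A]

/-- For `X ^ n = 1` and a primitive `n`-th root of unity `ω`, the projection onto the
`ω ^ j`-eigenspace of `X`. -/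
noncomputable def rootProj (ω : ℂ) (n : ℕ) (X : A) (j : ℕ) : A :=
  (n : ℂ)⁻¹ • ∑ k ∈ Finset.range n, ((ω ^ j)⁻¹ • X) ^ k

theorem smul_mul_rootProj {ω : ℂ} {n : ℕ} (hω : ω ^ n = 1) {X : A} (hX : X ^ n = 1) (j : ℕ) :
    ((ω ^ j)⁻¹ • X) * rootProj ω n X j = rootProj ω n X j := by
  set w := (ω ^ j)⁻¹ • X with hw
  have hwn : w ^ n = 1 := by
    rw [hw, smul_pow, hX, inv_pow, ← pow_mul, mul_comm, pow_mul, hω]; simp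
  have := mul_geom_sum w n
  rw [hwn, sub_self, sub_mul, one_mul, sub_eq_zero] at this
  rw [rootProj, ← hw, mul_smul_comm, this]

theorem mul_rootProj {ω : ℂ} {n : ℕ} (hn : n ≠ 0) (hω : ω ^ n = 1) {X : A} (hX : X ^ n = 1)
    (j : ℕ) : X * rootProj ω n X j = ω ^ j • rootProj ω n X j := by
  have h0 : ω ^ j ≠ 0 := pow_ne_zero _ (by rintro rfl; simp [hn] at hω)
  conv_rhs => rw [← smul_mul_rootProj hω hX j]
  rw [smul_mul_assoc, smul_smul, mul_inv_cancel₀ h0, one_smul]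

theorem pow_mul_rootProj {ω : ℂ} {n : ℕ} (hn : n ≠ 0) (hω : ω ^ n = 1) {X : A} (hX : X ^ n = 1)
    (j k : ℕ) : X ^ k * rootProj ω n X j = ω ^ (j * k) • rootProj ω n X j := by
  induction k with
  | zero => simp
  | succ k ih =>
    rw [pow_succ', mul_assoc, ih, mul_smul_comm, mul_rootProj hn hω hX, smul_smul]
    ring_nf

theorem isIdempotentElem_rootProj {ω : ℂ} {n : ℕ} (hn : n ≠ 0) (hω : ω ^ n = 1) {X : A}
    (hX : X ^ n = 1) (j : ℕ) : IsIdempotentElem (rootProj ω n X j) := by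
  have key : ∀ k, ((ω ^ j)⁻¹ • X) ^ k * rootProj ω n X j = rootProj ω n X j := by
    intro k
    induction k with
    | zero => simp
    | succ k ih => rw [pow_succ, mul_assoc, smul_mul_rootProj hω hX, ih]
  rw [IsIdempotentElem]
  nth_rw 1 [rootProj]
  rw [smul_mul_assoc, Finset.sum_mul, Finset.sum_congr rfl (fun k _ => key k), Finset.sum_const,
    Finset.card_range, ← Nat.cast_smul_eq_nsmul ℂ, smul_smul, inv_mul_cancel₀ (by simpa using hn),
    one_smul]

theorem sum_rootProj {ω : ℂ} {n : ℕ} (hn : n ≠ 0) (hω : IsPrimitiveRoot ω n) (X : A) :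
    ∑ j ∈ Finset.range n, rootProj ω n X j = 1 := by
  simp only [rootProj]
  rw [← Finset.smul_sum, Finset.sum_comm]
  rw [Finset.sum_eq_single_of_mem 0 (by simpa using Nat.pos_of_ne_zero hn)]
  · simp [← Nat.cast_smul_eq_nsmul ℂ, smul_smul, hn]
  · intro k hk hk0
    have h1 : ∀ j, ((ω ^ j)⁻¹ • X) ^ k = ((ω⁻¹ ^ k) ^ j) • X ^ k := by
      intro j
      rw [smul_pow, inv_pow, inv_pow, inv_pow, ← pow_mul, ← pow_mul, mul_comm]
    simp only [h1]
    rw [← Finset.sum_smul, geom_sum_eq_zero_of_pow_eq_one, zero_smul]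
    · rw [← pow_mul, mul_comm, pow_mul, inv_pow, hω.pow_eq_one]; simp
    · exact hω.inv.pow_ne_one_of_pos_of_lt hk0 (Finset.mem_range.1 hk)

theorem pow_eq_sum_rootProj {ω : ℂ} {n : ℕ} (hn : n ≠ 0) (hω : IsPrimitiveRoot ω n) {X : A}
    (hX : X ^ n = 1) (k : ℕ) :
    X ^ k = ∑ j ∈ Finset.range n, ω ^ (j * k) • rootProj ω n X j := by
  rw [← mul_one (X ^ k), ← sum_rootProj hn hω X, Finset.mul_sum]
  exact Finset.sum_congr rfl fun j _ => pow_mul_rootProj hn hω.pow_eq_one hX j k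

theorem Commute.rootProj_right {X Y : A} (h : Commute Y X) (ω : ℂ) (n j : ℕ) :
    Commute Y (rootProj ω n X j) := by
  refine Commute.smul_right (Commute.sum_right _ _ _ fun k _ => ?_) _
  exact ((h.smul_right _).pow_right _)

end Projections

/-! ### Traces through joint eigenspaces, and divisibility of dimensions -/

section Trace

variable {V : Type*} [AddCommGroup V] [Module ℂ V] [FiniteDimensional ℂ V]

theorem trace_eq_finrank_range {e : Module.End ℂ V} (he : IsIdempotentElem e) :
    LinearMap.trace ℂ V e = (Module.finrank ℂ (LinearMap.range e) : ℂ) :=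
  (LinearMap.IsIdempotentElem.isProj_range e he).trace

/-- The multiplicities `c j i` are the dimensions of the joint eigenspaces, which is why they are
natural numbers and add up over `j` to the dimension of an eigenspace of `Y`. -/
theorem trace_pow_mul_pow {ζ η : ℂ} {q N : ℕ} (hq : q ≠ 0) (hN : N ≠ 0)
    (hζ : IsPrimitiveRoot ζ q) (hη : IsPrimitiveRoot η N) {X Y : Module.End ℂ V}
    (hX : X ^ q = 1) (hY : Y ^ N = 1) (hXY : Commute X Y) :
    ∃ c : ℕ → ℕ → ℕ,
      (∀ k l, LinearMap.trace ℂ V (X ^ k * Y ^ l) =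
        ∑ j ∈ Finset.range q, ∑ i ∈ Finset.range N, (ζ ^ (j * k) * η ^ (i * l)) * (c j i : ℂ)) ∧
      ∀ i, ∑ j ∈ Finset.range q, c j i =
        Module.finrank ℂ (LinearMap.range (rootProj η N Y i)) := by
  have hid : ∀ j i, IsIdempotentElem (rootProj ζ q X j * rootProj η N Y i) := fun j i =>
    IsIdempotentElem.mul_of_commute ((hXY.rootProj_right η N i).symm.rootProj_right ζ q j).symm
      (isIdempotentElem_rootProj hq hζ.pow_eq_one hX j)
      (isIdempotentElem_rootProj hN hη.pow_eq_one hY i)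
  refine ⟨fun j i => Module.finrank ℂ (LinearMap.range (rootProj ζ q X j * rootProj η N Y i)),
    fun k l => ?_, fun i => ?_⟩
  · rw [pow_eq_sum_rootProj hq hζ hX, pow_eq_sum_rootProj hN hη hY, Finset.sum_mul_sum, map_sum]
    refine Finset.sum_congr rfl fun j _ => ?_
    rw [map_sum]
    refine Finset.sum_congr rfl fun i _ => ?_
    rw [smul_mul_smul_comm, map_smul, trace_eq_finrank_range (hid j i), smul_eq_mul]
  · have : (∑ j ∈ Finset.range q, (Module.finrank ℂ
        (LinearMap.range (rootProj ζ q X j * rootProj η N Y i)) : ℂ)) =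
        Module.finrank ℂ (LinearMap.range (rootProj η N Y i)) := by
      rw [← trace_eq_finrank_range (isIdempotentElem_rootProj hN hη.pow_eq_one hY i),
        Finset.sum_congr rfl fun j _ => (trace_eq_finrank_range (hid j i)).symm, ← map_sum,
        ← Finset.sum_mul, sum_rootProj hq hζ, one_mul]
    exact_mod_cast this

/-- If two invertible operators commute up to a scalar `μ`, and both commute with an idempotent `F`,
then `μ ^ rank F = 1`. -/
theorem pow_finrank_range_eq_one {F T Z : Module.End ℂ V} {μ : ℂ}
    (hT : IsUnit T) (hZ : IsUnit Z) (hTF : Commute T F) (hZF : Commute Z F)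
    (h : T * Z = μ • (Z * T)) : μ ^ Module.finrank ℂ (LinearMap.range F) = 1 := by
  have inv : ∀ {S : Module.End ℂ V}, Commute S F → ∀ v ∈ LinearMap.range F,
      S v ∈ LinearMap.range F := by
    rintro S hS _ ⟨v, rfl⟩
    exact ⟨S v, (LinearMap.congr_fun hS v).symm⟩
  have unit : ∀ {S : Module.End ℂ V} (hS : Commute S F), IsUnit S →
      LinearMap.det (S.restrict (inv hS)) ≠ 0 := by
    intro S hS hu
    -- An injective endomorphism of the finite-dimensional range is invertible, so both determinants
    -- can be cancelled when the relation is restricted there.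
    have : Function.Injective (S.restrict (inv hS)) := by
      intro v w hvw
      have h1 := congrArg Subtype.val hvw
      simp only [LinearMap.coe_restrict_apply] at h1
      exact Subtype.ext (((Module.End.isUnit_iff S).1 hu).1 h1)
    have h2 : IsUnit (S.restrict (inv hS)) := (LinearMap.isUnit_iff_ker_eq_bot _).2
      (LinearMap.ker_eq_bot.2 this)
    exact (h2.map LinearMap.det).ne_zero
  have key : T.restrict (inv hTF) * Z.restrict (inv hZF) =
      μ • (Z.restrict (inv hZF) * T.restrict (inv hTF)) := by
    ext v
    have := LinearMap.congr_fun h (v : V)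
    simpa using this
  have hdet := congrArg LinearMap.det key
  rw [LinearMap.det_smul, map_mul, map_mul, mul_comm (LinearMap.det (Z.restrict _))] at hdet
  exact (mul_eq_right₀ (mul_ne_zero (unit hTF hT) (unit hZF hZ))).1 hdet.symm

end Trace

/-! ### Mean squared conjugates of cyclotomic integers -/

section Cyclotomic

open Polynomial

/-- A form of AM-GM, from `log x ≤ x - 1`. -/
theorem card_le_sum_of_one_le_prod {ι : Type*} (s : Finset ι) (x : ι → ℝ)
    (hx : ∀ i ∈ s, 0 < x i) (h : 1 ≤ ∏ i ∈ s, x i) : (s.card : ℝ) ≤ ∑ i ∈ s, x i := by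
  have h1 : 0 ≤ ∑ i ∈ s, Real.log (x i) := by
    rw [← Real.log_prod fun i hi => (hx i hi).ne']
    exact Real.log_nonneg h
  have h2 : ∑ i ∈ s, Real.log (x i) ≤ ∑ i ∈ s, (x i - 1) :=
    Finset.sum_le_sum fun i hi => Real.log_le_sub_one_of_pos (hx i hi)
  rw [Finset.sum_sub_distrib, Finset.sum_const, nsmul_eq_mul, mul_one] at h2
  linarith

/-- The product is the resultant of `f` with the monic integral polynomial `cyclotomic N ℤ`. -/
theorem exists_int_eq_prod_primitiveRoots (N : ℕ) [NeZero N] (f : ℤ[X]) :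
    ∃ m : ℤ, ∏ μ ∈ primitiveRoots N ℂ, aeval μ f = (m : ℂ) := by
  refine ⟨resultant (cyclotomic N ℤ) f, ?_⟩
  have h := resultant_eq_prod_eval (cyclotomic N ℂ) (f.map (Int.castRingHom ℂ)) f.natDegree
    natDegree_map_le (IsAlgClosed.splits _)
  rw [(cyclotomic.monic N ℂ).leadingCoeff, one_pow, one_mul, cyclotomic.roots_eq_primitiveRoots_val,
    ← map_cyclotomic N (Int.castRingHom ℂ), resultant_map_map,
    (cyclotomic.monic N ℤ).natDegree_map] at h
  rw [← eq_intCast (Int.castRingHom ℂ), h]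
  simp only [aeval_def, eval_map]
  rfl

theorem aeval_ne_zero_of_isPrimitiveRoot {N : ℕ} (hN : 0 < N) {f : ℤ[X]} {μ ν : ℂ}
    (hμ : IsPrimitiveRoot μ N) (hν : IsPrimitiveRoot ν N) (h : aeval μ f ≠ 0) :
    aeval ν f ≠ 0 := by
  intro h0
  apply h
  have h1 := minpoly.isIntegrallyClosed_dvd (hν.isIntegral hN) h0
  rw [← cyclotomic_eq_minpoly hν hN, cyclotomic_eq_minpoly hμ hN] at h1
  obtain ⟨r, rfl⟩ := h1
  simp

/-- The product of the conjugates is a nonzero integer, so AM-GM applies to their squared absolute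
values. -/
theorem card_le_sum_norm_sq_aeval_primitiveRoots {N : ℕ} (hN : 0 < N) {f : ℤ[X]} {μ : ℂ}
    (hμ : IsPrimitiveRoot μ N) (h : aeval μ f ≠ 0) :
    (N.totient : ℝ) ≤ ∑ ν ∈ primitiveRoots N ℂ, ‖aeval ν f‖ ^ 2 := by
  have : NeZero N := ⟨hN.ne'⟩
  rw [← hμ.card_primitiveRoots]
  have hne : ∀ ν ∈ primitiveRoots N ℂ, aeval ν f ≠ 0 := fun ν hν =>
    aeval_ne_zero_of_isPrimitiveRoot hN hμ ((mem_primitiveRoots hN).1 hν) h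
  refine card_le_sum_of_one_le_prod _ _ (fun ν hν => by have := hne ν hν; positivity) ?_
  obtain ⟨m, hm⟩ := exists_int_eq_prod_primitiveRoots N f
  rw [Finset.prod_pow, ← norm_prod, hm]
  have hm0 : m ≠ 0 := by
    rintro rfl
    exact Finset.prod_ne_zero_iff.2 hne (by simpa using hm)
  have : (1 : ℝ) ≤ ‖(m : ℂ)‖ := by
    rw [Complex.norm_intCast]
    exact_mod_cast Int.one_le_abs hm0
  exact one_le_pow₀ this

theorem sum_primitiveRoots {M : Type*} [AddCommMonoid M] {N : ℕ} (hN : 0 < N) {η : ℂ}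
    (hη : IsPrimitiveRoot η N) (F : ℂ → M) :
    ∑ ν ∈ primitiveRoots N ℂ, F ν = ∑ l ∈ Finset.range N with N.Coprime l, F (η ^ l) := by
  symm
  refine Finset.sum_bij (fun l _ => η ^ l) ?_ ?_ ?_ fun _ _ => rfl
  · intro l hl
    rw [mem_primitiveRoots hN]
    exact hη.pow_of_coprime l (Finset.mem_filter.1 hl).2.symm
  · intro a ha b hb hab
    simp only [Finset.mem_filter, Finset.mem_range] at ha hb
    exact hη.pow_inj ha.1 hb.1 hab
  · intro ν hν
    rw [mem_primitiveRoots hN] at hν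
    have : NeZero N := ⟨hN.ne'⟩
    obtain ⟨i, hi, hc, rfl⟩ := (hη.isPrimitiveRoot_iff).1 hν
    exact ⟨i, by simpa [hi] using hc.symm, rfl⟩

/-- The exponents of the primitive `N`-th roots of unity. -/
abbrev unitExponents (N : ℕ) : Finset ℕ := {l ∈ Finset.range N | N.Coprime l}

/-- The vector of the conjugates `f (η ^ l)`, `l` coprime to `N`, as an additive map of `f`. -/
noncomputable def conjugateVector (N : ℕ) (η : ℂ) :
    ℤ[X] →+ EuclideanSpace ℂ (unitExponents N) where
  toFun f := WithLp.toLp 2 fun l => aeval (η ^ (l : ℕ)) f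
  map_zero' := by ext; simp
  map_add' f g := by ext; simp

theorem norm_sq_conjugateVector (N : ℕ) (η : ℂ) (f : ℤ[X]) :
    ‖conjugateVector N η f‖ ^ 2 = ∑ l ∈ unitExponents N, ‖aeval (η ^ l) f‖ ^ 2 := by
  rw [EuclideanSpace.norm_sq_eq, ← Finset.sum_coe_sort (unitExponents N)]
  rfl

theorem totient_le_norm_sq {N : ℕ} (hN : 0 < N) {η : ℂ} (hη : IsPrimitiveRoot η N)
    (v : EuclideanSpace ℂ (unitExponents N)) (hv : v ∈ (conjugateVector N η).range)
    (h0 : v ≠ 0) : (N.totient : ℝ) ≤ ‖v‖ ^ 2 := by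
  obtain ⟨f, rfl⟩ := hv
  rw [norm_sq_conjugateVector, ← sum_primitiveRoots hN hη fun ν => ‖aeval ν f‖ ^ 2]
  have : ∃ l : unitExponents N, aeval (η ^ (l : ℕ)) f ≠ 0 := by
    by_contra! hc
    exact h0 (by ext l; exact hc l)
  obtain ⟨l, hl⟩ := this
  exact card_le_sum_norm_sq_aeval_primitiveRoots hN
    (hη.pow_of_coprime l (Finset.mem_filter.1 l.2).2.symm) hl

end Cyclotomic

/-! ### Plancherel and defects of the fibers modulo `p ^ a` -/

section Fibers

open Finset

variable {H : Type*} [NormedAddCommGroup H]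

theorem norm_sum_sq_le_card_mul {ι : Type*} (s : Finset ι) (w : ι → H) :
    ‖∑ i ∈ s, w i‖ ^ 2 ≤ s.card * ∑ i ∈ s, ‖w i‖ ^ 2 :=
  (pow_le_pow_left₀ (norm_nonneg _) (norm_sum_le _ _) 2).trans sq_sum_le_card_mul_sum_sq

/-- The defect in the Cauchy-Schwarz inequality for the norm of `∑ u < p, b u`. -/
noncomputable def fiberDefect (p : ℕ) (b : ℕ → H) : ℝ :=
  p * ∑ u ∈ range p, ‖b u‖ ^ 2 - ‖∑ u ∈ range p, b u‖ ^ 2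

theorem fiberDefect_congr {p : ℕ} {b c : ℕ → H} (h : ∀ u < p, b u = c u) :
    fiberDefect p b = fiberDefect p c := by
  rw [fiberDefect, fiberDefect, sum_congr rfl fun u hu => by rw [h u (mem_range.1 hu)],
    sum_congr rfl fun u hu => h u (mem_range.1 hu)]

theorem fiberDefect_nonneg (p : ℕ) (b : ℕ → H) : 0 ≤ fiberDefect p b := by
  have := norm_sum_sq_le_card_mul (range p) b
  rw [card_range] at this
  exact sub_nonneg.2 this

variable [InnerProductSpace ℂ H]

theorem sum_range_mul_eq_sum_sum {M : Type*} [AddCommMonoid M] (m p : ℕ) (f : ℕ → M) :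
    ∑ j ∈ range (m * p), f j = ∑ r ∈ range m, ∑ u ∈ range p, f (r + m * u) := by
  induction p with
  | zero => simp
  | succ p ih =>
    rw [mul_add_one, sum_range_add, ih, ← sum_add_distrib]
    exact sum_congr rfl fun r _ => by rw [sum_range_succ, add_comm r]

/-- Plancherel for the finite Fourier transform with vector coefficients. -/
theorem sum_norm_sq_fourier {n : ℕ} {ω : ℂ} (hω : IsPrimitiveRoot ω n) (b : ℕ → H) :
    ∑ k ∈ range n, ‖∑ j ∈ range n, ω ^ (j * k) • b j‖ ^ 2 = n * ∑ j ∈ range n, ‖b j‖ ^ 2 := by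
  rcases Nat.eq_zero_or_pos n with rfl | hn
  · simp
  have hω1 : ‖ω‖ = 1 := hω.norm'_eq_one hn.ne'
  have hconj : (starRingEnd ℂ) ω = ω⁻¹ := by
    rw [Complex.inv_eq_conj hω1]
  have hω0 : ω ≠ 0 := hω.ne_zero hn.ne'
  have orth : ∀ i ∈ range n, ∀ j ∈ range n,
      ∑ k ∈ range n, (starRingEnd ℂ) (ω ^ (i * k)) * ω ^ (j * k) = if j = i then (n : ℂ) else 0 := by
    intro i hi j hj
    have h1 : ∀ k, (starRingEnd ℂ) (ω ^ (i * k)) * ω ^ (j * k) = ((ω ^ i)⁻¹ * ω ^ j) ^ k := by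
      intro k
      rw [map_pow, hconj, mul_pow, inv_pow, inv_pow, ← pow_mul, ← pow_mul]
    simp only [h1]
    split_ifs with h
    · subst h
      simp [hω0]
    · refine geom_sum_eq_zero_of_pow_eq_one ?_ fun h2 => h ?_
      · rw [mul_pow, inv_pow, ← pow_mul, ← pow_mul, mul_comm i, mul_comm j, pow_mul, pow_mul,
          hω.pow_eq_one]
        simp
      · rw [inv_mul_eq_one₀ (pow_ne_zero _ hω0)] at h2
        exact (hω.pow_inj (mem_range.1 hi) (mem_range.1 hj) h2).symm
  have hc : ((∑ k ∈ range n, ‖∑ j ∈ range n, ω ^ (j * k) • b j‖ ^ 2 : ℝ) : ℂ) =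
      ((n * ∑ j ∈ range n, ‖b j‖ ^ 2 : ℝ) : ℂ) := by
    push_cast
    have h2 : ∀ k, ((‖∑ j ∈ range n, ω ^ (j * k) • b j‖ : ℂ)) ^ 2 =
        ∑ i ∈ range n, ∑ j ∈ range n,
          ((starRingEnd ℂ) (ω ^ (i * k)) * ω ^ (j * k)) * inner ℂ (b i) (b j) := by
      intro k
      rw [← Complex.coe_algebraMap, ← inner_self_eq_norm_sq_to_K (𝕜 := ℂ), sum_inner]
      refine sum_congr rfl fun i _ => ?_
      rw [inner_sum]
      refine sum_congr rfl fun j _ => ?_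
      rw [inner_smul_left, inner_smul_right, mul_assoc]
    simp only [h2]
    rw [sum_comm, mul_sum]
    refine sum_congr rfl fun i hi => ?_
    rw [sum_comm]
    have h3 : ∀ j ∈ range n, ∑ k ∈ range n,
        ((starRingEnd ℂ) (ω ^ (i * k)) * ω ^ (j * k)) * inner ℂ (b i) (b j) =
        if j = i then (n : ℂ) * inner ℂ (b i) (b i) else 0 := by
      intro j hj
      rw [← sum_mul, orth i hi j hj]
      split_ifs with h
      · rw [h]
      · rw [zero_mul]
    rw [sum_congr rfl h3, sum_ite_eq', if_pos hi, inner_self_eq_norm_sq_to_K]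
    rfl
  exact_mod_cast hc

/-- The defect depends only on differences: it equals the sum of `‖b u - b v‖ ^ 2` over pairs `u <
v`. -/
theorem fiberDefect_sub_const (p : ℕ) (b : ℕ → H) (e : H) :
    fiberDefect p (fun u => b u - e) = fiberDefect p b := by
  have h1 : ∀ x y : H, ‖x - y‖ ^ 2 = ‖x‖ ^ 2 - 2 * (inner ℂ x y : ℂ).re + ‖y‖ ^ 2 :=
    fun x y => norm_sub_sq (𝕜 := ℂ) x y
  have h2 : ‖(p • e : H)‖ ^ 2 = (p : ℝ) ^ 2 * ‖e‖ ^ 2 := by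
    rw [← Nat.cast_smul_eq_nsmul ℂ, norm_smul, mul_pow]
    simp
  have h3 : (inner ℂ (∑ u ∈ range p, b u) (p • e) : ℂ).re =
      p * ∑ u ∈ range p, (inner ℂ (b u) e : ℂ).re := by
    rw [← Nat.cast_smul_eq_nsmul ℂ, inner_smul_right, sum_inner, ← Complex.re_sum]
    simp
  simp only [fiberDefect, sum_sub_distrib, sum_const, card_range, h1, h2, h3, sum_add_distrib,
    ← mul_sum, nsmul_eq_mul]
  ring

theorem fiberDefect_eq_zero_of_const {p : ℕ} {b : ℕ → H} (h : ∀ u < p, b u = b 0) :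
    fiberDefect p b = 0 := by
  rw [← fiberDefect_sub_const p b (b 0), fiberDefect_congr (c := fun _ => 0)]
  · simp [fiberDefect]
  · intro u hu
    rw [h u hu, sub_self]

variable {A : AddSubgroup H} {M : ℝ}

/-- After translation by `b 0`, let `s` terms be nonzero. Cauchy-Schwarz on these alone bounds the
defect below by `(p - s) * s * M`, and `s * (p - s) ≥ p - 1` for `1 ≤ s ≤ p - 1`. -/
theorem sub_one_mul_le_fiberDefect (hM : 0 ≤ M) (hA : ∀ r ∈ A, r ≠ 0 → M ≤ ‖r‖ ^ 2) {p : ℕ}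
    {b : ℕ → H} (hb : ∀ u, b u ∈ A) (hnc : ∃ u < p, b u ≠ b 0) :
    ((p : ℝ) - 1) * M ≤ fiberDefect p b := by
  classical
  obtain ⟨u₀, hu₀, hne⟩ := hnc
  rw [← fiberDefect_sub_const p b (b 0)]
  set w : ℕ → H := fun u => b u - b 0 with hw
  set s := (range p).filter fun u => w u ≠ 0 with hs
  have hs1 : 1 ≤ s.card := card_pos.2 ⟨u₀, by simp [hs, hu₀, hw, sub_ne_zero, hne]⟩
  have hsp : s.card + 1 ≤ p := by
    have : s ⊆ (range p).erase 0 := by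
      intro u hu
      rw [hs, mem_filter] at hu
      refine mem_erase.2 ⟨?_, hu.1⟩
      rintro rfl
      exact hu.2 (sub_self _)
    have h2 := card_le_card this
    rw [card_erase_of_mem (mem_range.2 (by lia)), card_range] at h2
    lia
  have e1 : ∑ u ∈ range p, w u = ∑ u ∈ s, w u := (sum_filter_ne_zero _).symm
  have e2 : ∑ u ∈ range p, ‖w u‖ ^ 2 = ∑ u ∈ s, ‖w u‖ ^ 2 := by
    symm
    refine sum_subset (filter_subset _ _) fun u hu hu' => ?_
    have : w u = 0 := by
      by_contra h
      exact hu' (mem_filter.2 ⟨hu, h⟩)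
    simp [this]
  have h1 := norm_sum_sq_le_card_mul s w
  have h2 : s.card * M ≤ ∑ u ∈ s, ‖w u‖ ^ 2 := by
    rw [← nsmul_eq_mul]
    exact card_nsmul_le_sum _ _ _ fun u hu =>
      hA _ (A.sub_mem (hb u) (hb 0)) (mem_filter.1 hu).2
  rw [fiberDefect, e1, e2]
  have c1 : (1 : ℝ) ≤ s.card := by exact_mod_cast hs1
  have c2 : (s.card : ℝ) + 1 ≤ p := by exact_mod_cast hsp
  have h3 : ((p : ℝ) - s.card) * (s.card * M) ≤ (p - s.card) * ∑ u ∈ s, ‖w u‖ ^ 2 :=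
    mul_le_mul_of_nonneg_left h2 (by linarith)
  have h4 : 0 ≤ (((s.card : ℝ) - 1) * (p - s.card - 1)) * M :=
    mul_nonneg (mul_nonneg (by linarith) (by linarith)) hM
  nlinarith

/-- Translation by the mean `e`, which lies in `A`, makes the sum vanish. The terms are not all
zero, so at least two are nonzero. -/
theorem two_mul_le_fiberDefect (hA : ∀ r ∈ A, r ≠ 0 → M ≤ ‖r‖ ^ 2) {p : ℕ}
    {b : ℕ → H} (hb : ∀ u, b u ∈ A) (hnc : ∃ u < p, b u ≠ b 0) {e : H} (he : e ∈ A)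
    (hsum : ∑ u ∈ range p, b u = p • e) : 2 * (p : ℝ) * M ≤ fiberDefect p b := by
  classical
  obtain ⟨u₀, hu₀, hne⟩ := hnc
  rw [← fiberDefect_sub_const p b e]
  set w : ℕ → H := fun u => b u - e with hw
  have hw0 : ∑ u ∈ range p, w u = 0 := by
    simp [hw, sum_sub_distrib, hsum]
  have hone : ∃ u ∈ range p, w u ≠ 0 := by
    by_contra! hc
    have a1 := hc u₀ (mem_range.2 hu₀)
    have a2 := hc 0 (mem_range.2 (by lia))
    exact hne ((sub_eq_zero.1 a1).trans (sub_eq_zero.1 a2).symm)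
  obtain ⟨u₁, hu₁, h1⟩ := hone
  have htwo : ∃ u ∈ (range p).erase u₁, w u ≠ 0 := by
    by_contra! hc
    rw [← add_sum_erase _ _ hu₁, sum_eq_zero hc, add_zero] at hw0
    exact h1 hw0
  obtain ⟨u₂, hu₂, h2⟩ := htwo
  have hwA : ∀ u, w u ∈ A := fun u => A.sub_mem (hb u) he
  have h3 : ‖w u₂‖ ^ 2 ≤ ∑ u ∈ (range p).erase u₁, ‖w u‖ ^ 2 :=
    single_le_sum (f := fun u => ‖w u‖ ^ 2) (fun u _ => by positivity) hu₂
  have h4 := hA _ (hwA u₁) h1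
  have h5 := hA _ (hwA u₂) h2
  rw [fiberDefect, hw0, ← add_sum_erase _ _ hu₁, norm_zero]
  have : (0 : ℝ) ≤ p := Nat.cast_nonneg p
  nlinarith [mul_le_mul_of_nonneg_left (add_le_add h4 (h5.trans h3)) this]

/-- Subtract from Plancherel over all `k` its analogue over the multiples of `p`, where the
transform sees only the sums over the fibers of `j` modulo `p ^ a`. -/
theorem sum_coprime_norm_sq_fourier {p a : ℕ} (hp : p.Prime) {ζ : ℂ}
    (hζ : IsPrimitiveRoot ζ (p ^ (a + 1))) (b : ℕ → H) :
    ∑ k ∈ unitExponents (p ^ (a + 1)), ‖∑ j ∈ range (p ^ (a + 1)), ζ ^ (j * k) • b j‖ ^ 2 =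
      p ^ a * ∑ r ∈ range (p ^ a), fiberDefect p fun u => b (r + p ^ a * u) := by
  have htot := sum_norm_sq_fourier hζ b
  have hp0 := hp.pos
  have hξ : IsPrimitiveRoot (ζ ^ p) (p ^ a) := hζ.pow (pow_pos hp0 _) (pow_succ' p a)
  have hpart := sum_norm_sq_fourier hξ fun r => ∑ u ∈ range p, b (r + p ^ a * u)
  rw [← sum_filter_add_sum_filter_not _ (fun k => (p ^ (a + 1)).Coprime k)] at htot
  have hmul : ∑ k ∈ range (p ^ (a + 1)) with ¬ (p ^ (a + 1)).Coprime k,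
      ‖∑ j ∈ range (p ^ (a + 1)), ζ ^ (j * k) • b j‖ ^ 2 =
      ∑ k ∈ range (p ^ a), ‖∑ r ∈ range (p ^ a), (ζ ^ p) ^ (r * k) •
        ∑ u ∈ range p, b (r + p ^ a * u)‖ ^ 2 := by
    symm
    refine sum_bij (fun k _ => p * k) ?_ ?_ ?_ ?_
    · intro k hk
      rw [mem_range] at hk
      rw [mem_filter, mem_range, pow_succ']
      refine ⟨Nat.mul_lt_mul_of_pos_left hk hp0, fun h => ?_⟩
      exact hp.one_lt.ne' (Nat.Coprime.eq_one_of_dvd (h.coprime_mul_right.coprime_mul_right_right)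
        dvd_rfl)
    · intro k _ l _ h
      exact Nat.eq_of_mul_eq_mul_left hp0 h
    · intro k hk
      rw [mem_filter, mem_range, Nat.coprime_pow_left_iff (Nat.succ_pos a),
        hp.coprime_iff_not_dvd, not_not] at hk
      obtain ⟨hk1, l, rfl⟩ := hk
      refine ⟨l, mem_range.2 ?_, rfl⟩
      rw [pow_succ'] at hk1
      exact lt_of_mul_lt_mul_left hk1 (Nat.zero_le p)
    · intro k _
      congr 2
      rw [pow_succ, sum_range_mul_eq_sum_sum]
      refine sum_congr rfl fun r _ => ?_
      rw [smul_sum]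
      refine sum_congr rfl fun u _ => ?_
      congr 1
      have : (r + p ^ a * u) * (p * k) = p * (r * k) + p ^ (a + 1) * (u * k) := by ring
      rw [this, pow_add, pow_mul ζ p, pow_mul ζ (p ^ (a + 1)), hζ.pow_eq_one, one_pow, mul_one]
  rw [hmul, hpart] at htot
  rw [eq_sub_of_add_eq htot]
  simp only [fiberDefect]
  rw [sum_sub_distrib, ← mul_sum, pow_succ, sum_range_mul_eq_sum_sum]
  push_cast
  ring

/-- If the coefficients `b j` lie in a group of vectors of squared norm at least `M`, and their
sum is divisible by `p`, then the mean of the squared norms of the conjugates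
of `∑ j, ζ ^ j • b j ≠ 0`, `ζ` a primitive root of unity of `p`-power order, is at least `2 * M`. -/
theorem two_mul_totient_mul_le_sum_norm_sq {p a : ℕ} (hp : p.Prime) {ζ : ℂ}
    (hζ : IsPrimitiveRoot ζ (p ^ (a + 1))) (hM : 0 ≤ M) (hA : ∀ r ∈ A, r ≠ 0 → M ≤ ‖r‖ ^ 2)
    {b : ℕ → H} (hb : ∀ j, b j ∈ A) {e : H} (he : e ∈ A)
    (hsum : ∑ j ∈ range (p ^ (a + 1)), b j = p • e)
    (hne : ∃ k ∈ unitExponents (p ^ (a + 1)), ∑ j ∈ range (p ^ (a + 1)), ζ ^ (j * k) • b j ≠ 0) :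
    2 * ((p ^ (a + 1)).totient : ℝ) * M ≤
      ∑ k ∈ unitExponents (p ^ (a + 1)), ‖∑ j ∈ range (p ^ (a + 1)), ζ ^ (j * k) • b j‖ ^ 2 := by
  classical
  have hform := sum_coprime_norm_sq_fourier hp hζ b
  set Q : ℕ → ℝ := fun r => fiberDefect p fun u => b (r + p ^ a * u) with hQ
  have hQ0 : ∀ r, 0 ≤ Q r := fun r => fiberDefect_nonneg _ _
  have hp1 : (1 : ℝ) ≤ p := by exact_mod_cast hp.one_lt.le
  suffices h : 2 * ((p : ℝ) - 1) * M ≤ ∑ r ∈ range (p ^ a), Q r by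
    rw [hform, Nat.totient_prime_pow_succ hp, Nat.cast_mul, Nat.cast_pow,
      Nat.cast_sub hp.one_lt.le, Nat.cast_one]
    calc 2 * ((p : ℝ) ^ a * (p - 1)) * M = p ^ a * (2 * (p - 1) * M) := by ring
      _ ≤ _ := mul_le_mul_of_nonneg_left h (by positivity)
  have hex : ∃ r ∈ range (p ^ a), ∃ u < p, b (r + p ^ a * u) ≠ b (r + p ^ a * 0) := by
    by_contra! hc
    have : ∑ r ∈ range (p ^ a), Q r = 0 :=
      sum_eq_zero fun r hr => fiberDefect_eq_zero_of_const (hc r hr)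
    rw [this, mul_zero] at hform
    obtain ⟨k, hk, hk0⟩ := hne
    have h0 := (sum_eq_zero_iff_of_nonneg fun k _ => by positivity).1 hform k hk
    exact hk0 (norm_eq_zero.1 (pow_eq_zero_iff two_ne_zero |>.1 h0))
  obtain ⟨r₀, hr₀, hnc⟩ := hex
  -- Two nonconstant fibers contribute `(p - 1) * M` each. If there is only one, the constant fibers
  -- have sums divisible by `p`, hence so does the remaining one, and its defect is at least `2 * p
  -- * M`.
  by_cases hother : ∃ r ∈ (range (p ^ a)).erase r₀, ∃ u < p, b (r + p ^ a * u) ≠ b (r + p ^ a * 0)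
  · obtain ⟨r₁, hr₁, hnc₁⟩ := hother
    have h1 : ((p : ℝ) - 1) * M ≤ Q r₀ := sub_one_mul_le_fiberDefect hM hA (fun u => hb _) hnc
    have h2 : ((p : ℝ) - 1) * M ≤ Q r₁ := sub_one_mul_le_fiberDefect hM hA (fun u => hb _) hnc₁
    rw [← add_sum_erase _ _ hr₀]
    have h3 : Q r₁ ≤ ∑ r ∈ (range (p ^ a)).erase r₀, Q r :=
      single_le_sum (fun r _ => hQ0 r) hr₁
    linarith
  · push Not at hother
    have h1 : ∑ u ∈ range p, b (r₀ + p ^ a * u) =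
        p • (e - ∑ r ∈ (range (p ^ a)).erase r₀, b (r + p ^ a * 0)) := by
      have h2 := hsum
      rw [pow_succ, sum_range_mul_eq_sum_sum, ← add_sum_erase _ _ hr₀] at h2
      rw [smul_sub, ← h2, smul_sum]
      symm
      rw [sub_eq_iff_eq_add]
      congr 1
      refine sum_congr rfl fun r hr => ?_
      rw [sum_congr rfl fun u hu => hother r hr u (mem_range.1 hu), sum_const, card_range]
    have h2 : 2 * (p : ℝ) * M ≤ Q r₀ := two_mul_le_fiberDefect hA (fun u => hb _) hnc
      (A.sub_mem he (A.sum_mem fun r _ => hb _)) h1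
    have h3 : Q r₀ ≤ ∑ r ∈ range (p ^ a), Q r := single_le_sum (fun r _ => hQ0 r) hr₀
    nlinarith

end Fibers

/-! ### Elements of coprime order in nilpotent groups, and Chinese remainders -/

section Groups

/-- Induction on central quotients makes the commutator of `a` and `b` central. Its `m`-th and
`n`-th powers are then trivial, so it is trivial. -/
theorem commute_of_coprime_of_isNilpotent (G : Type*) [Group G] [Group.IsNilpotent G] :
    ∀ (m n : ℕ) (a b : G), m.Coprime n → a ^ m = 1 → b ^ n = 1 → Commute a b := by
  refine Group.nilpotent_center_quotient_ind (P := fun G _ _ => ∀ (m n : ℕ) (a b : G),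
    m.Coprime n → a ^ m = 1 → b ^ n = 1 → Commute a b) G
    (fun _ _ _ _ _ _ _ _ _ _ => Subsingleton.elim _ _) fun G _ _ ih => ?_
  intro m n a b hmn ha hb
  have h1 := ih m n (a : G ⧸ Subgroup.center G) (b : G ⧸ Subgroup.center G) hmn
    (by rw [← QuotientGroup.mk_pow, ha]; rfl) (by rw [← QuotientGroup.mk_pow, hb]; rfl)
  set c := a * b * a⁻¹ * b⁻¹ with hc
  have hcz : c ∈ Subgroup.center G := by
    rw [← QuotientGroup.eq_one_iff, hc]
    change (a : G ⧸ Subgroup.center G) * b * (a : G ⧸ Subgroup.center G)⁻¹ *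
      (b : G ⧸ Subgroup.center G)⁻¹ = 1
    rw [h1.eq]
    group
  have hcomm : ∀ g, Commute c g := fun g => (Subgroup.mem_center_iff.1 hcz g).symm
  have hcn : c ^ n = 1 := by
    have e : a * b * a⁻¹ = c * b := by rw [hc]; group
    have := conj_pow (i := n) (a := a) (b := b)
    rwa [e, (hcomm b).mul_pow, hb, mul_one, mul_one, mul_inv_cancel] at this
  have hcm : c ^ m = 1 := by
    have e : b * a⁻¹ * b⁻¹ = c * a⁻¹ := by rw [(hcomm a⁻¹).eq, hc]; group
    have := conj_pow (i := m) (a := b) (b := a⁻¹)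
    rwa [e, (hcomm _).mul_pow, inv_pow, ha, inv_one, mul_one, mul_one, mul_inv_cancel] at this
  have hc1 : c = 1 := by
    have := pow_gcd_eq_one.2 ⟨hcm, hcn⟩
    rwa [hmn.gcd_eq_one, pow_one] at this
  rw [hc] at hc1
  exact mul_inv_eq_iff_eq_mul.1 (mul_inv_eq_one.1 hc1) |>.trans rfl

theorem sum_unitExponents_mul {M : Type*} [AddCommMonoid M] {q N : ℕ} (hq : 0 < q) (hN : 0 < N)
    (hqN : q.Coprime N) (F : ℕ → ℕ → M) :
    ∑ m ∈ unitExponents (q * N), F (m % q) (m % N) =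
      ∑ k ∈ unitExponents q, ∑ l ∈ unitExponents N, F k l := by
  have hmod : ∀ {n m : ℕ}, n.Coprime (m % n) ↔ n.Coprime m := by
    intro n m
    rw [Nat.coprime_comm, Nat.coprime_comm (m := m), Nat.Coprime, (Nat.mod_modEq m n).gcd_eq]
  rw [← Finset.sum_product']
  refine Finset.sum_bij (fun m _ => (m % q, m % N)) ?_ ?_ ?_ fun _ _ => rfl
  · intro m hm
    simp only [Finset.mem_filter, Finset.mem_range, Finset.mem_product] at hm ⊢
    exact ⟨⟨Nat.mod_lt _ hq, hmod.2 hm.2.coprime_mul_right⟩,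
      Nat.mod_lt _ hN, hmod.2 hm.2.coprime_mul_left⟩
  · intro a ha b hb hab
    simp only [Finset.mem_filter, Finset.mem_range] at ha hb
    have h := (Nat.modEq_and_modEq_iff_modEq_mul hqN).1 ⟨congrArg Prod.fst hab, congrArg Prod.snd hab⟩
    rwa [Nat.ModEq, Nat.mod_eq_of_lt ha.1, Nat.mod_eq_of_lt hb.1] at h
  · rintro ⟨k, l⟩ hkl
    simp only [Finset.mem_filter, Finset.mem_range, Finset.mem_product] at hkl
    obtain ⟨m, hmk, hml⟩ := Nat.chineseRemainder hqN k l
    have h1 : m % (q * N) ≡ k [MOD q] := ((Nat.mod_modEq m (q * N)).of_mul_right N).trans hmk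
    have h2 : m % (q * N) ≡ l [MOD N] := ((Nat.mod_modEq m (q * N)).of_mul_left q).trans hml
    have e1 : m % (q * N) % q = k := by rw [h1, Nat.mod_eq_of_lt hkl.1.1]
    have e2 : m % (q * N) % N = l := by rw [h2, Nat.mod_eq_of_lt hkl.2.1]
    refine ⟨m % (q * N), ?_, by rw [e1, e2]⟩
    simp only [Finset.mem_filter, Finset.mem_range]
    refine ⟨Nat.mod_lt _ (Nat.mul_pos hq hN), Nat.Coprime.mul_left ?_ ?_⟩
    · rw [← hmod, e1]; exact hkl.1.2
    · rw [← hmod, e2]; exact hkl.2.2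

theorem exists_pow_eq_mul_pow {G : Type*} [Group G] {q N : ℕ}
    (hqN : q.Coprime N) {g : G} (hg : g ^ (q * N) = 1) :
    ∃ x y : G, x ^ q = 1 ∧ y ^ N = 1 ∧ Commute x y ∧
      ∀ m, g ^ m = x ^ (m % q) * y ^ (m % N) := by
  obtain ⟨e, he1, he0⟩ := Nat.chineseRemainder hqN 1 0
  obtain ⟨f, hf0, hf1⟩ := Nat.chineseRemainder hqN 0 1
  have hx : (g ^ e) ^ q = 1 := by
    obtain ⟨r, rfl⟩ := (Nat.modEq_zero_iff_dvd).1 he0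
    rw [← pow_mul, mul_right_comm, mul_comm N q, pow_mul, hg, one_pow]
  have hy : (g ^ f) ^ N = 1 := by
    obtain ⟨r, rfl⟩ := (Nat.modEq_zero_iff_dvd).1 hf0
    rw [← pow_mul, mul_right_comm, pow_mul, hg, one_pow]
  refine ⟨g ^ e, g ^ f, hx, hy, (Commute.refl g).pow_pow e f, fun m => ?_⟩
  rw [← pow_eq_pow_mod m hx, ← pow_eq_pow_mod m hy, ← ((Commute.refl g).pow_pow e f).mul_pow,
    ← pow_add]
  congr 1
  have : e + f ≡ 1 [MOD q * N] :=
    (Nat.modEq_and_modEq_iff_modEq_mul hqN).1 ⟨he1.add hf0, he0.add hf1⟩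
  have h2 := pow_eq_pow_mod (e + f) hg
  rw [this, ← pow_eq_pow_mod 1 hg, pow_one] at h2
  exact h2.symm

end Groups

/-! ### The lower bound for traces of commuting operators -/

section TraceBound

open Finset Polynomial

variable {V : Type*} [AddCommGroup V] [Module ℂ V] [FiniteDimensional ℂ V]

/-- Commuting operators `X`, `Y` with `X ^ q = 1`, `q` a power of `p`, and `Y ^ N = 1`, where the
eigenspaces of `Y` have dimensions divisible by `p`: if some `trace (X ^ k * Y ^ l)` with `k`, `l`
coprime to `q`, `N` is not zero, then the mean of their squared absolute values is at least `2`. -/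
theorem two_mul_totient_mul_totient_le_sum_norm_trace_sq {p a N : ℕ} (hp : p.Prime) (hN : 0 < N)
    {X Y : Module.End ℂ V} (hX : X ^ p ^ (a + 1) = 1) (hY : Y ^ N = 1) (hXY : Commute X Y)
    {η : ℂ} (hη : IsPrimitiveRoot η N)
    (hdvd : ∀ i, p ∣ Module.finrank ℂ (LinearMap.range (rootProj η N Y i)))
    (hne : ∃ k ∈ unitExponents (p ^ (a + 1)), ∃ l ∈ unitExponents N,
      LinearMap.trace ℂ V (X ^ k * Y ^ l) ≠ 0) :
    2 * ((p ^ (a + 1)).totient : ℝ) * N.totient ≤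
      ∑ k ∈ unitExponents (p ^ (a + 1)), ∑ l ∈ unitExponents N,
        ‖LinearMap.trace ℂ V (X ^ k * Y ^ l)‖ ^ 2 := by
  have hq : p ^ (a + 1) ≠ 0 := pow_ne_zero _ hp.ne_zero
  have hζ := Complex.isPrimitiveRoot_exp _ hq
  set ζ := Complex.exp (2 * Real.pi * Complex.I / (p ^ (a + 1) : ℕ))
  obtain ⟨c, hc, hcsum⟩ := trace_pow_mul_pow hq hN.ne' hζ hη hX hY hXY
  choose d hd using hdvd
  -- `f j` evaluates at `η ^ l` to the coefficient of `ζ ^ (j * k)` in the trace of `X ^ k * Y ^ l`.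
  set f : ℕ → ℤ[X] := fun j => ∑ i ∈ range N, C (c j i : ℤ) * Polynomial.X ^ i with hf
  set b : ℕ → EuclideanSpace ℂ (unitExponents N) := fun j => conjugateVector N η (f j) with hb
  have hbl : ∀ j (l : unitExponents N), b j l =
      ∑ i ∈ range N, η ^ (i * (l : ℕ)) * (c j i : ℂ) := by
    intro j l
    change aeval (η ^ (l : ℕ)) (f j) = _
    simp only [hf, map_sum, map_mul, map_pow, aeval_X, aeval_C]
    refine sum_congr rfl fun i _ => ?_
    rw [← pow_mul, mul_comm (l : ℕ), mul_comm]
    simp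
  have hS : ∀ k (l : unitExponents N), (∑ j ∈ range (p ^ (a + 1)), ζ ^ (j * k) • b j) l =
      LinearMap.trace ℂ V (X ^ k * Y ^ (l : ℕ)) := by
    intro k l
    rw [hc]
    simp only [WithLp.ofLp_sum, WithLp.ofLp_smul, Finset.sum_apply, Pi.smul_apply, hbl, smul_eq_mul,
      mul_sum, mul_assoc]
  have hnorm : ∀ k, ‖∑ j ∈ range (p ^ (a + 1)), ζ ^ (j * k) • b j‖ ^ 2 =
      ∑ l ∈ unitExponents N, ‖LinearMap.trace ℂ V (X ^ k * Y ^ l)‖ ^ 2 := by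
    intro k
    rw [EuclideanSpace.norm_sq_eq, ← Finset.sum_coe_sort (unitExponents N)]
    exact sum_congr rfl fun l _ => by rw [hS]
  have hsum : ∑ j ∈ range (p ^ (a + 1)), b j =
      p • conjugateVector N η (∑ i ∈ range N, C (d i : ℤ) * Polynomial.X ^ i) := by
    rw [← map_nsmul, hb, ← map_sum]
    congr 1
    rw [hf, sum_comm, smul_sum]
    refine sum_congr rfl fun i _ => ?_
    rw [← sum_mul, ← map_sum, ← Nat.cast_sum, hcsum, hd, nsmul_eq_mul]
    push_cast
    simp [mul_assoc]
  have := two_mul_totient_mul_le_sum_norm_sq (A := (conjugateVector N η).range)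
    (M := N.totient) hp hζ (Nat.cast_nonneg _) (fun r hr h0 => totient_le_norm_sq hN hη r hr h0)
    (b := b) (fun j => ⟨f j, rfl⟩) ⟨_, rfl⟩ hsum ?_
  · simpa only [hnorm] using this
  · obtain ⟨k, hk, l, hl, h0⟩ := hne
    refine ⟨k, hk, fun hz => h0 ?_⟩
    rw [← hS k ⟨l, hl⟩, hz]
    rfl

end TraceBound

/-! ### Nonlinear irreducible representations of nilpotent groups -/

namespace Representation

variable {G V : Type*} [Group G] [AddCommGroup V] [Module ℂ V]
  (ρ : Representation ℂ G V)

theorem nontrivial_of_isIrreducible [ρ.IsIrreducible] : Nontrivial V := by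
  by_contra h
  rw [not_nontrivial_iff_subsingleton] at h
  exact bot_ne_top (α := Subrepresentation ρ)
    (Subrepresentation.toSubmodule_injective (Subsingleton.elim _ _))

theorem isUnit_apply (g : G) : IsUnit (ρ g) := (Group.isUnit g).map ρ

theorem eq_one_of_eq_smul [Nontrivial V] {T : Module.End ℂ V} (hT : IsUnit T) {c : ℂ}
    (h : T = c • T) : c = 1 := by
  have h1 : (1 - c) • T = 0 := by rw [sub_smul, one_smul, ← h, sub_self]
  exact (sub_eq_zero.1 ((smul_eq_zero.1 h1).resolve_right hT.ne_zero)).symm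

/-- Conjugating `ρ t` by `ρ z` multiplies it by `c` but preserves its trace, and similarly for `ρ
z`. Thus `c ≠ 1` makes both characters vanish. -/
theorem character_eq_smul_of_mul_eq_smul {z t : G} {c : ℂ}
    (h : ρ z * ρ t = c • (ρ t * ρ z)) :
    ρ.character t = c * ρ.character t ∧ ρ.character z = c * ρ.character z := by
  have hinv : ∀ g, ρ g * ρ g⁻¹ = 1 := fun g => by rw [← map_mul, mul_inv_cancel, map_one]
  constructor
  · have h1 := congrArg (LinearMap.trace ℂ V) (congrArg (· * ρ z⁻¹) h)
    simp only [smul_mul_assoc, map_smul, mul_assoc, hinv, mul_one, smul_eq_mul] at h1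
    rw [← mul_assoc, ← map_mul, ← map_mul] at h1
    exact (ρ.char_conj t z).symm.trans h1
  · have h1 := congrArg (LinearMap.trace ℂ V) (congrArg (ρ t⁻¹ * ·) h)
    have hl : ρ t⁻¹ * (ρ t * ρ z) = ρ z := by
      rw [← mul_assoc, ← map_mul, inv_mul_cancel, map_one, one_mul]
    simp only [mul_smul_comm, map_smul, hl, smul_eq_mul] at h1
    rw [← map_mul, ← map_mul] at h1
    refine Eq.trans ?_ h1
    have := ρ.char_conj z t⁻¹
    rw [inv_inv, mul_assoc] at this
    exact this.symm

theorem finrank_eq_one_of_forall_eq_smul_one [ρ.IsIrreducible]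
    (h : ∀ g, ∃ c : ℂ, ρ g = c • 1) : Module.finrank ℂ V = 1 := by
  have := ρ.nontrivial_of_isIrreducible
  obtain ⟨v, hv⟩ := exists_ne (0 : V)
  let S : Subrepresentation ρ := ⟨ℂ ∙ v, fun g w hw => by
    obtain ⟨c, hc⟩ := h g
    rw [hc]
    exact Submodule.smul_mem _ c hw⟩
  have hS : S = ⊤ := by
    refine (eq_bot_or_eq_top S).resolve_left fun h0 => hv ?_
    have h1 : (ℂ ∙ v) = ⊥ := congrArg Subrepresentation.toSubmodule h0
    exact Submodule.span_singleton_eq_bot.1 h1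
  have h1 : (ℂ ∙ v) = ⊤ := congrArg Subrepresentation.toSubmodule hS
  rw [← finrank_top ℂ V, ← h1, finrank_span_singleton hv]

variable [FiniteDimensional ℂ V]

theorem exists_eq_smul_one_of_commute [ρ.IsIrreducible] {T : Module.End ℂ V}
    (hT : ∀ g, Commute T (ρ g)) : ∃ c : ℂ, T = c • 1 := by
  obtain ⟨c, hc⟩ := (IsIrreducible.algebraMap_intertwiningMap_bijective_of_isAlgClosed
    (ρ := ρ)).2 ⟨T, fun g => hT g⟩
  exact ⟨c, (congrArg IntertwiningMap.toLinearMap hc).symm⟩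

/-- A nonlinear irreducible representation of a nilpotent group has an operator `ρ z` that is not
scalar but commutes up to scalars with all operators `ρ t`. -/
theorem exists_commute_up_to_scalar [ρ.IsIrreducible] (hG : Group.IsNilpotent G)
    (hV : Module.finrank ℂ V ≠ 1) :
    ∃ z : G, (∀ t, ∃ c : ℂ, ρ z * ρ t = c • (ρ t * ρ z)) ∧ ∃ t, ¬ Commute (ρ z) (ρ t) := by
  classical
  -- Take `z` in the first term of the upper central series that does not act by scalars: its
  -- commutators lie one term lower, so they do. Schur's lemma then gives a `t` not commuting with
  -- it.
  have hns : ∃ i, ∃ z ∈ Subgroup.upperCentralSeries G i, ∀ c : ℂ, ρ z ≠ c • 1 := by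
    obtain ⟨n, hn⟩ := hG.nilpotent'
    by_contra! hc
    exact hV (ρ.finrank_eq_one_of_forall_eq_smul_one fun g => hc n g (hn ▸ Subgroup.mem_top g))
  obtain ⟨z, hz, hzc⟩ := Nat.find_spec hns
  have hpos : Nat.find hns ≠ 0 := by
    intro h0
    rw [h0, Subgroup.upperCentralSeries_zero, Subgroup.mem_bot] at hz
    exact hzc 1 (by rw [hz, map_one, one_smul])
  obtain ⟨i, hi⟩ := Nat.exists_eq_succ_of_ne_zero hpos
  rw [hi, Nat.succ_eq_add_one, Subgroup.mem_upperCentralSeries_succ_iff] at hz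
  refine ⟨z, fun t => ?_, ?_⟩
  · have h1 := Nat.find_min hns (m := i) (by lia)
    push Not at h1
    obtain ⟨c, hc⟩ := h1 _ (hz t)
    refine ⟨c, ?_⟩
    have : z * t = z * t * z⁻¹ * t⁻¹ * (t * z) := by group
    have hc' : ρ (z * t * z⁻¹ * t⁻¹) = c • 1 := hc
    rw [← map_mul, this, map_mul, hc', map_mul, smul_mul_assoc, one_mul]
  · by_contra! hc
    obtain ⟨c, hc⟩ := ρ.exists_eq_smul_one_of_commute hc
    exact hzc c hc

/-- A nonlinear irreducible character of a finite nilpotent group vanishes on more than half of the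
group. -/
theorem two_mul_ncard_support_lt [Finite G] [ρ.IsIrreducible] (hG : Group.IsNilpotent G)
    (hV : Module.finrank ℂ V ≠ 1) : 2 * {g | ρ.character g ≠ 0}.ncard < Nat.card G := by
  obtain ⟨z, hz, t₀, ht₀⟩ := ρ.exists_commute_up_to_scalar hG hV
  let C : Subgroup G :=
    { carrier := {t | Commute (ρ z) (ρ t)}
      mul_mem' := fun {a b} ha hb => by
        rw [Set.mem_ofPred_eq, map_mul]
        exact Commute.mul_right ha hb
      one_mem' := by rw [Set.mem_ofPred_eq, map_one]; exact Commute.one_right _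
      inv_mem' := fun {a} ha => by
        have h1 : ρ a * ρ a⁻¹ = 1 := by rw [← map_mul, mul_inv_cancel, map_one]
        have h2 : ρ a⁻¹ * ρ a = 1 := by rw [← map_mul, inv_mul_cancel, map_one]
        exact Commute.units_inv_right (u := ⟨ρ a, ρ a⁻¹, h1, h2⟩) ha }
  have hone : ∀ {t : G} {c : ℂ}, ρ z * ρ t = c • (ρ t * ρ z) → c = 1 → t ∈ C := by
    intro t c h hc
    rw [hc, one_smul] at h
    exact h
  have hz0 : ρ.character z = 0 := by
    obtain ⟨c, hc⟩ := hz t₀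
    by_contra h0
    exact ht₀ (hone hc ((mul_eq_right₀ h0).1 (ρ.character_eq_smul_of_mul_eq_smul hc).2.symm))
  have hsub : {g | ρ.character g ≠ 0} ⊂ (C : Set G) := by
    refine ⟨fun t ht => ?_, fun h => h (show z ∈ C from Commute.refl _) hz0⟩
    obtain ⟨c, hc⟩ := hz t
    exact hone hc ((mul_eq_right₀ ht).1 (ρ.character_eq_smul_of_mul_eq_smul hc).1.symm)
  have h1 := Set.ncard_lt_ncard hsub (Set.toFinite _)
  have h2 : C.index ≠ 1 := by
    rw [Ne, Subgroup.index_eq_one]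
    exact fun h => ht₀ (show t₀ ∈ C from h ▸ Subgroup.mem_top t₀)
  have h3 : 2 ≤ C.index := by
    have := C.index_ne_zero_of_finite
    lia
  have h4 : Nat.card C = (C : Set G).ncard := Nat.card_coe_set_eq _
  rw [← C.card_mul_index, h4]
  calc _ < 2 * (C : Set G).ncard := by lia
    _ = (C : Set G).ncard * 2 := mul_comm _ _
    _ ≤ _ := Nat.mul_le_mul_left _ h3

end Representation

theorem pow_mul_pow_eq_smul {A : Type*} [Ring A] [Algebra ℂ A] {S T : A} {c : ℂ}
    (h : S * T = c • (T * S)) (i j : ℕ) : S ^ i * T ^ j = c ^ (i * j) • (T ^ j * S ^ i) := by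
  have h1 : ∀ j, S * T ^ j = c ^ j • (T ^ j * S) := by
    intro j
    induction j with
    | zero => simp
    | succ j ih =>
      rw [pow_succ, ← mul_assoc, ih, smul_mul_assoc, mul_assoc, h, mul_smul_comm, smul_smul,
        mul_assoc, pow_succ]
  induction i with
  | zero => simp
  | succ i ih =>
    rw [pow_succ', mul_assoc, ih, mul_smul_comm, ← mul_assoc, h1, smul_mul_assoc, smul_smul,
      mul_assoc]
    ring_nf

namespace Representation

variable {G V : Type*} [Group G] [AddCommGroup V] [Module ℂ V] [FiniteDimensional ℂ V]
  (ρ : Representation ℂ G V)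

/-- Let the commutator scalar `c` have order `p * s`. Raising `z` to `N` and `t` to `s * N` gives
the scalar `c ^ (s * N * N)`, still of order `p`. These powers have `p`-power order, so they commute
with elements of order dividing `N`. -/
theorem exists_prime_mul_eq_smul [Finite G] [ρ.IsIrreducible] (hG : Group.IsNilpotent G)
    (hV : Module.finrank ℂ V ≠ 1) :
    ∃ p : ℕ, p.Prime ∧ p ∣ Nat.card G ∧ ∀ a N, Nat.card G = p ^ a * N → ¬ p ∣ N →
      ∃ (z t : G) (μ : ℂ), IsPrimitiveRoot μ p ∧ ρ z * ρ t = μ • (ρ t * ρ z) ∧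
        ∀ y : G, y ^ N = 1 → Commute z y ∧ Commute t y := by
  have := ρ.nontrivial_of_isIrreducible
  obtain ⟨z, hz, t, ht⟩ := ρ.exists_commute_up_to_scalar hG hV
  obtain ⟨c, hc⟩ := hz t
  have hcn : c ^ Nat.card G = 1 := by
    have h := pow_mul_pow_eq_smul hc (Nat.card G) 1
    rw [← map_pow, pow_card_eq_one', map_one, one_mul, mul_one, mul_one] at h
    exact eq_one_of_eq_smul ((ρ.isUnit_apply t).pow 1) h
  have hord : orderOf c ≠ 1 := by
    rw [Ne, orderOf_eq_one_iff]
    rintro rfl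
    rw [one_smul] at hc
    exact ht hc
  have hr : orderOf c ≠ 0 := (orderOf_pos_iff.2
    (isOfFinOrder_iff_pow_eq_one.2 ⟨_, Nat.card_pos, hcn⟩)).ne'
  set p := (orderOf c).minFac with hp
  have hpp : p.Prime := Nat.minFac_prime hord
  obtain ⟨s, hs⟩ := (orderOf c).minFac_dvd
  refine ⟨p, hpp, (Nat.minFac_dvd _).trans (orderOf_dvd_of_pow_eq_one hcn), fun a N hN hpN => ?_⟩
  have hcop : (p ^ a).Coprime N := Nat.Coprime.pow_left _ ((hpp.coprime_iff_not_dvd).2 hpN)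
  have hker : ∀ g : G, (g ^ N) ^ p ^ a = 1 := fun g => by
    rw [← pow_mul, mul_comm, ← hN, pow_card_eq_one']
  refine ⟨z ^ N, (t ^ s) ^ N, c ^ (N * (s * N)), ?_, ?_, fun y hy => ⟨?_, ?_⟩⟩
  · have h1 : IsPrimitiveRoot (c ^ s) p :=
      (IsPrimitiveRoot.orderOf c).pow (Nat.pos_of_ne_zero hr) (hs.trans (mul_comm _ _))
    have h2 := h1.pow_of_coprime (N * N) (Nat.Coprime.mul_left
      ((hpp.coprime_iff_not_dvd).2 hpN).symm ((hpp.coprime_iff_not_dvd).2 hpN).symm)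
    rw [← pow_mul] at h2
    convert h2 using 2
    ring
  · have := pow_mul_pow_eq_smul hc N (s * N)
    rwa [← map_pow, ← map_pow, pow_mul t] at this
  · exact commute_of_coprime_of_isNilpotent G _ _ _ _ hcop (hker _) hy
  · exact commute_of_coprime_of_isNilpotent G _ _ _ _ hcop (hker _) hy

/-- If a nonlinear irreducible character of a finite nilpotent group does not vanish at `g`, then
the mean of its squared absolute values at the generators `g ^ m` is at least `2`. -/
theorem two_mul_totient_le_sum_norm_character_sq [Finite G] [ρ.IsIrreducible]
    (hG : Group.IsNilpotent G) (hV : Module.finrank ℂ V ≠ 1) {g : G} (hg : ρ.character g ≠ 0) :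
    2 * ((Nat.card G).totient : ℝ) ≤
      ∑ m ∈ unitExponents (Nat.card G), ‖ρ.character (g ^ m)‖ ^ 2 := by
  obtain ⟨p, hp, hdvd, h⟩ := ρ.exists_prime_mul_eq_smul hG hV
  obtain ⟨a', N, hpN, hcard⟩ := Nat.exists_eq_pow_mul_and_not_dvd Nat.card_pos.ne' p hp.ne_one
    (n := Nat.card G)
  obtain ⟨z, t, μ, hμ, hzt, hcomm⟩ := h a' N hcard hpN
  have ha' : a' ≠ 0 := by
    rintro rfl
    rw [pow_zero, one_mul] at hcard
    exact hpN (hcard ▸ hdvd)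
  obtain ⟨a, rfl⟩ := Nat.exists_eq_succ_of_ne_zero ha'
  rw [Nat.succ_eq_add_one] at hcard
  have hN : 0 < N := Nat.pos_of_ne_zero fun h0 => hpN (h0 ▸ dvd_zero p)
  have hq : 0 < p ^ (a + 1) := pow_pos hp.pos _
  have hcop : (p ^ (a + 1)).Coprime N := Nat.Coprime.pow_left _ ((hp.coprime_iff_not_dvd).2 hpN)
  obtain ⟨x, y, hx, hy, hxy, hpow⟩ := exists_pow_eq_mul_pow hcop (g := g)
    (by rw [← hcard, pow_card_eq_one'])
  have hη := Complex.isPrimitiveRoot_exp N hN.ne'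
  obtain ⟨hzy, hty⟩ := hcomm y hy
  have hchar : ∀ m, ρ.character (g ^ m) =
      LinearMap.trace ℂ V (ρ x ^ (m % p ^ (a + 1)) * ρ y ^ (m % N)) := by
    intro m
    rw [hpow, character, map_mul, map_pow, map_pow]
  rw [hcard]
  simp only [hchar]
  rw [sum_unitExponents_mul hq hN hcop fun k l => ‖LinearMap.trace ℂ V (ρ x ^ k * ρ y ^ l)‖ ^ 2,
    Nat.totient_mul hcop, Nat.cast_mul, ← mul_assoc]
  refine two_mul_totient_mul_totient_le_sum_norm_trace_sq hp hN (by rw [← map_pow, hx, map_one])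
    (by rw [← map_pow, hy, map_one]) (hxy.map ρ) hη (fun i => ?_) ?_
  · exact hμ.dvd_of_pow_eq_one _ (pow_finrank_range_eq_one (ρ.isUnit_apply z) (ρ.isUnit_apply t)
      ((hzy.map ρ).rootProj_right _ _ _) ((hty.map ρ).rootProj_right _ _ _) hzt)
  -- The exponent `1 % n` rather than `1` covers `n = 1`, where `unitExponents 1 = {0}`.
  · have hmem : ∀ n, 0 < n → 1 % n ∈ unitExponents n := by
      intro n hn
      refine Finset.mem_filter.2 ⟨Finset.mem_range.2 (Nat.mod_lt _ hn), ?_⟩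
      rw [Nat.coprime_comm, Nat.Coprime, (Nat.mod_modEq 1 n).gcd_eq, Nat.gcd_one_left]
    refine ⟨_, hmem _ hq, _, hmem _ hN, ?_⟩
    rwa [← hchar, pow_one]

theorem exists_character_pow_eq_sum [Finite G] (g : G) {ω : ℂ}
    (hω : IsPrimitiveRoot ω (Nat.card G)) :
    ∃ c : ℕ → ℕ, ∀ m, ρ.character (g ^ m) =
      ∑ j ∈ Finset.range (Nat.card G), ω ^ (j * m) * (c j : ℂ) := by
  obtain ⟨c, hc, -⟩ := trace_pow_mul_pow (X := ρ g) (Y := 1) (N := 1) (η := 1) Nat.card_pos.ne'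
    one_ne_zero hω IsPrimitiveRoot.one (by rw [← map_pow, pow_card_eq_one', map_one]) (one_pow 1)
    (Commute.one_right _)
  refine ⟨fun j => c j 0, fun m => ?_⟩
  have := hc m 0
  rw [← map_pow, pow_zero, mul_one] at this
  rw [character, this]
  simp

theorem character_inv [Finite G] (g : G) : ρ.character g⁻¹ = (starRingEnd ℂ) (ρ.character g) := by
  have hω := Complex.isPrimitiveRoot_exp (Nat.card G) Nat.card_pos.ne'
  set ω := Complex.exp (2 * Real.pi * Complex.I / (Nat.card G : ℕ))
  obtain ⟨c, hc⟩ := ρ.exists_character_pow_eq_sum g hω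
  have h1 := hc 1
  have h2 := hc (Nat.card G - 1)
  have hinv : g ^ (Nat.card G - 1) = g⁻¹ := by
    rw [eq_inv_iff_mul_eq_one, ← pow_succ, Nat.sub_add_cancel Nat.card_pos, pow_card_eq_one']
  rw [pow_one] at h1
  rw [hinv] at h2
  rw [h1, h2, map_sum]
  refine Finset.sum_congr rfl fun j _ => ?_
  rw [map_mul, map_natCast, map_pow, ← Complex.inv_eq_conj (hω.norm'_eq_one Nat.card_pos.ne')]
  congr 1
  rw [mul_one, inv_pow]
  refine eq_inv_of_mul_eq_one_left ?_
  rw [← pow_add, ← mul_add_one, Nat.sub_add_cancel (show 1 ≤ Nat.card G from Nat.card_pos), mul_comm, pow_mul, hω.pow_eq_one,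
    one_pow]

theorem character_pow_card_eq_one [Finite G] (hV : Module.finrank ℂ V = 1) (g : G) :
    ρ.character g ^ Nat.card G = 1 := by
  obtain ⟨v, hv, hspan⟩ := finrank_eq_one_iff'.1 hV
  have hsc : ∀ T : Module.End ℂ V, T = LinearMap.trace ℂ V T • 1 := by
    intro T
    obtain ⟨c, hc⟩ := hspan (T v)
    have hT : T = c • 1 := by
      ext w
      obtain ⟨d, rfl⟩ := hspan w
      simp [← hc]
    have : LinearMap.trace ℂ V T = c := by
      rw [hT, map_smul, LinearMap.trace_one, hV]
      simp
    rw [this]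
    exact hT
  have h1 : (ρ g) ^ Nat.card G = 1 := by rw [← map_pow, pow_card_eq_one', map_one]
  rw [hsc (ρ g), smul_pow, one_pow] at h1
  have h2 := LinearMap.congr_fun h1 v
  have : (LinearMap.trace ℂ V (ρ g) ^ Nat.card G) • v = (1 : ℂ) • v := by simpa using h2
  exact smul_left_injective ℂ hv this

end Representation

/-! ### Irreducibility under change of model -/

open scoped MonoidAlgebra

namespace Representation

section

variable {G V : Type*} [Group G] [AddCommGroup V] [Module ℂ V] (σ : Representation ℂ G V)

theorem isIrreducible_of_equiv {W : Type*} [AddCommGroup W] [Module ℂ W]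
    {σ : Representation ℂ G V} {ρ : Representation ℂ G W} (φ : Equiv σ ρ) [hσ : σ.IsIrreducible] :
    ρ.IsIrreducible := by
  rw [irreducible_iff_isSimpleModule_asModule] at hσ ⊢
  let f := IntertwiningMap.equivLinearMapAsModule σ ρ φ.toIntertwiningMap
  have hf : Function.Bijective f := φ.toLinearEquiv.bijective
  exact (LinearEquiv.ofBijective f hf).isSimpleModule_iff.1 hσ

theorem character_mem_Irr [FiniteDimensional ℂ V] [σ.IsIrreducible] : σ.character ∈ Irr G := by
  let e := (Module.finBasis ℂ V).equivFun
  let ρ : Representation ℂ G (Fin (Module.finrank ℂ V) → ℂ) :=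
    { toFun := fun g => e.conj (σ g)
      map_one' := by rw [map_one]; exact e.conj_id
      map_mul' := fun g h => by rw [map_mul]; exact e.conj_comp _ _ }
  have φ : Equiv σ ρ := Equiv.mk e fun g => by
    ext v
    simp [ρ, LinearEquiv.conj_apply]
  exact ⟨_, ρ, isIrreducible_of_equiv φ, (char_iso φ).symm⟩

theorem isIrreducible_ofModule' (M : Type*) [AddCommGroup M] [Module ℂ M] [Module ℂ[G] M]
    [IsScalarTower ℂ ℂ[G] M] [IsSimpleModule ℂ[G] M] :
    (ofModule' (k := ℂ) (G := G) M).IsIrreducible := by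
  have hnt : Nontrivial M := IsSimpleModule.nontrivial ℂ[G] M
  have hbt : Nontrivial (Subrepresentation (ofModule' (k := ℂ) (G := G) M)) :=
    ⟨⊥, ⊤, fun hbt => bot_ne_top (α := Submodule ℂ M) (congrArg Subrepresentation.toSubmodule hbt)⟩
  refine ⟨fun W => ?_⟩
  let W' : Submodule ℂ[G] M :=
    { carrier := W.toSubmodule
      add_mem' := W.toSubmodule.add_mem
      zero_mem' := W.toSubmodule.zero_mem
      smul_mem' := fun r x hx => by
        induction r using MonoidAlgebra.induction_linear with
        | zero => rw [zero_smul]; exact W.toSubmodule.zero_mem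
        | add r s hr hs => rw [add_smul]; exact W.toSubmodule.add_mem hr hs
        | single g c =>
          have h1 : MonoidAlgebra.single g c = c • (MonoidAlgebra.single g (1 : ℂ)) := by simp
          rw [h1, smul_assoc]
          exact W.toSubmodule.smul_mem c (W.apply_mem_toSubmodule g hx) }
  refine (eq_bot_or_eq_top W').imp (fun h => ?_) (fun h => ?_) <;>
  · refine SetLike.ext fun x => ?_
    exact SetLike.ext_iff.1 h x

theorem isIrreducible_of_finrank_eq_one (h : Module.finrank ℂ V = 1) : σ.IsIrreducible := by
  have hs := (isSimpleModule_iff ℂ V).1 (isSimpleModule_iff_finrank_eq_one.2 h)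
  have hnt : Nontrivial (Subrepresentation σ) :=
    ⟨⊥, ⊤, fun hbt => bot_ne_top (congrArg Subrepresentation.toSubmodule hbt)⟩
  exact ⟨fun S => (eq_bot_or_eq_top S.toSubmodule).imp
    (fun h => Subrepresentation.toSubmodule_injective h)
    (fun h => Subrepresentation.toSubmodule_injective h)⟩

end

end Representation

theorem one_mem_Irr (G : Type*) [Group G] : (1 : G → ℂ) ∈ Irr G := by
  let σ : Representation ℂ G ℂ := Representation.trivial ℂ G ℂ
  have := σ.isIrreducible_of_finrank_eq_one (Module.finrank_self ℂ)
  convert σ.character_mem_Irr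
  ext g
  simp [Representation.character, σ]

theorem conj_eq_of_mem_Irr {G : Type*} [Group G] {χ : G → ℂ} (hχ : χ ∈ Irr G) (g h : G) :
    χ (h * g * h⁻¹) = χ g := by
  obtain ⟨n, ρ, hρ, rfl⟩ := hχ
  exact ρ.char_conj g h

/-! ### Orthonormality of irreducible characters and the Bessel inequality -/

section Orthogonality

variable {G : Type*} [Group G] [Fintype G]

open Representation

theorem inv_card_mul_sum_mul_conj {χ ψ : G → ℂ} (hχ : χ ∈ Irr G) (hψ : ψ ∈ Irr G)
    [Decidable (χ = ψ)] :
    (Nat.card G : ℂ)⁻¹ * ∑ g, χ g * (starRingEnd ℂ) (ψ g) = if χ = ψ then 1 else 0 := by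
  have : Invertible (Nat.card G : ℂ) :=
    invertibleOfNonzero (Nat.cast_ne_zero.2 Nat.card_pos.ne')
  obtain ⟨n, ρ, hρ, rfl⟩ := hχ
  obtain ⟨m, σ, hσ, rfl⟩ := hψ
  simp only [← character_inv]
  split_ifs with h
  · have h1 := char_orthonormal ρ ρ
    rw [if_pos ⟨Representation.Equiv.refl ρ⟩] at h1
    rw [← h]
    exact h1
  · rw [char_orthonormal ρ σ, if_neg]
    rintro ⟨φ⟩
    exact h (char_iso φ).symm

/-- Class functions, normalized so that the irreducible characters are orthonormal. -/
noncomputable def normalizedVector (χ : G → ℂ) : EuclideanSpace ℂ G :=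
  WithLp.toLp 2 fun g => (((√(Nat.card G : ℝ))⁻¹ : ℝ) : ℂ) * χ g

theorem orthonormal_normalizedVector :
    Orthonormal ℂ fun χ : Irr G => normalizedVector (χ : G → ℂ) := by
  classical
  rw [orthonormal_iff_ite]
  intro χ ψ
  have h := inv_card_mul_sum_mul_conj ψ.2 χ.2
  have hs : (((√(Nat.card G : ℝ))⁻¹ : ℝ) : ℂ) * (((√(Nat.card G : ℝ))⁻¹ : ℝ) : ℂ) =
      (Nat.card G : ℂ)⁻¹ := by
    rw [← Complex.ofReal_mul, ← mul_inv, Real.mul_self_sqrt (Nat.cast_nonneg _)]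
    push_cast
    rfl
  rw [PiLp.inner_apply]
  simp only [normalizedVector, RCLike.inner_apply, map_mul, Complex.conj_ofReal]
  rw [mul_sum_eq hs, h]
  simp only [Subtype.ext_iff, eq_comm]
where
  mul_sum_eq {s : ℂ} (hs : s * s = (Nat.card G : ℂ)⁻¹) {u v : G → ℂ} :
      ∑ g, s * u g * (s * v g) = (Nat.card G : ℂ)⁻¹ * ∑ g, u g * v g := by
    rw [Finset.mul_sum, ← hs]
    exact Finset.sum_congr rfl fun g _ => by ring

end Orthogonality

section Finite

variable {G : Type*} [Group G] [Finite G]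

theorem finite_Irr : (Irr G).Finite := by
  have := Fintype.ofFinite G
  exact (orthonormal_normalizedVector (G := G)).linearIndependent.finite

/-- The Bessel inequality for the indicator function of a conjugacy class. -/
theorem ncard_conjugatesOf_mul_sum_norm_sq_le (g : G) (s : Finset (Irr G)) :
    (conjugatesOf g).ncard * ∑ χ ∈ s, ‖(χ : G → ℂ) g‖ ^ 2 ≤ Nat.card G := by
  classical
  have := Fintype.ofFinite G
  set D : Finset G := (conjugatesOf g).toFinset with hD
  have hmem : ∀ h, h ∈ D ↔ IsConj g h := fun h => by rw [hD, Set.mem_toFinset]; exact Iff.rfl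
  have hcard : (conjugatesOf g).ncard = D.card := Set.ncard_eq_toFinset_card' _
  have hDpos : 0 < D.card := Finset.card_pos.2 ⟨g, (hmem g).2 (IsConj.refl g)⟩
  let x : EuclideanSpace ℂ G := WithLp.toLp 2 fun h => if h ∈ D then 1 else 0
  have hx : ‖x‖ ^ 2 = D.card := by
    rw [EuclideanSpace.norm_sq_eq]
    have : ∀ h : G, ‖x h‖ ^ 2 = if h ∈ D then 1 else 0 := by
      intro h
      change ‖if h ∈ D then (1 : ℂ) else 0‖ ^ 2 = _
      split_ifs <;> simp
    simp only [this]
    simp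
  have hin : ∀ χ : Irr G, ‖inner ℂ (normalizedVector (χ : G → ℂ)) x‖ ^ 2 =
      (D.card : ℝ) ^ 2 / Nat.card G * ‖(χ : G → ℂ) g‖ ^ 2 := by
    intro χ
    -- `χ` is constant on the class, so each of its elements contributes equally.
    have h1 : inner ℂ (normalizedVector (χ : G → ℂ)) x =
        D.card * ((((√(Nat.card G : ℝ))⁻¹ : ℝ) : ℂ) * (starRingEnd ℂ) ((χ : G → ℂ) g)) := by
      rw [PiLp.inner_apply, ← nsmul_eq_mul, ← Finset.sum_const, ← Finset.sum_filter_add_sum_filter_not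
        Finset.univ (· ∈ D)]
      rw [Finset.sum_eq_zero (s := Finset.univ.filter (· ∉ D)), add_zero]
      · refine Finset.sum_congr (by ext; simp) fun h hh => ?_
        have hh' : h ∈ D := by simpa using hh
        obtain ⟨k, rfl⟩ := isConj_iff.1 ((hmem h).1 hh')
        simp [normalizedVector, x, hh', conj_eq_of_mem_Irr χ.2]
      · intro h hh
        have hh' : h ∉ D := by simpa using hh
        simp [x, hh']
    rw [h1, norm_mul, norm_mul, Complex.norm_real, RCLike.norm_conj, Complex.norm_natCast, mul_pow,
      mul_pow, norm_inv, inv_pow, Real.norm_eq_abs, sq_abs, Real.sq_sqrt (Nat.cast_nonneg _)]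
    ring
  have hB := (orthonormal_normalizedVector (G := G)).sum_inner_products_le x (s := s)
  simp only [hin] at hB
  rw [← Finset.mul_sum, hx] at hB
  have hGpos : (0 : ℝ) < Nat.card G := Nat.cast_pos.2 Nat.card_pos
  have hDpos' : (0 : ℝ) < D.card := Nat.cast_pos.2 hDpos
  rw [hcard]
  rw [div_mul_eq_mul_div, div_le_iff₀ hGpos, pow_two, mul_assoc] at hB
  exact le_of_mul_le_mul_left hB hDpos'

end Finite

/-! ### Irreducible characters separate class functions -/

section Completeness

open Representation

variable {G : Type*} [Group G] [Fintype G]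

/-- By Schur's lemma the operator is scalar; its trace is zero by orthogonality. -/
theorem sum_smul_eq_zero_of_orthogonal {f : G → ℂ} (hf : ∀ g h, f (h * g * h⁻¹) = f g)
    (horth : ∀ χ ∈ Irr G, ∑ g, f g * χ g = 0) {V : Type*} [AddCommGroup V] [Module ℂ V]
    [FiniteDimensional ℂ V] (σ : Representation ℂ G V) [σ.IsIrreducible] :
    ∑ g, f g • σ g = 0 := by
  have hcomm : ∀ h, Commute (∑ g, f g • σ g) (σ h) := by
    intro h
    rw [Commute, SemiconjBy, Finset.sum_mul, Finset.mul_sum,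
      ← (MulAut.conj h).toEquiv.sum_comp (fun g => f g • σ g * σ h)]
    refine Finset.sum_congr rfl fun g _ => ?_
    change f (h * g * h⁻¹) • σ (h * g * h⁻¹) * σ h = _
    rw [hf, smul_mul_assoc, mul_smul_comm, ← map_mul, ← map_mul, inv_mul_cancel_right]
  obtain ⟨c, hc⟩ := σ.exists_eq_smul_one_of_commute hcomm
  have htr := congrArg (LinearMap.trace ℂ V) hc
  have hz : LinearMap.trace ℂ V (∑ g, f g • σ g) = 0 := by
    rw [map_sum, ← horth _ σ.character_mem_Irr]
    exact Finset.sum_congr rfl fun g _ => by rw [map_smul, smul_eq_mul]; rfl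
  have := σ.nontrivial_of_isIrreducible
  rw [hz, map_smul, LinearMap.trace_one, smul_eq_mul] at htr
  have hd : (Module.finrank ℂ V : ℂ) ≠ 0 := Nat.cast_ne_zero.2 Module.finrank_pos.ne'
  rw [hc, (mul_eq_zero.1 htr.symm).resolve_right hd, zero_smul]

/-- The central element `∑ f g • g` of the group algebra kills every simple left ideal. By
semisimplicity these span the algebra, so it kills `1`. -/
theorem eq_zero_of_orthogonal_Irr {f : G → ℂ} (hf : ∀ g h, f (h * g * h⁻¹) = f g)
    (horth : ∀ χ ∈ Irr G, ∑ g, f g * χ g = 0) : f = 0 := by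
  classical
  set a : ℂ[G] := ∑ g, MonoidAlgebra.single g (f g) with ha
  have hact : ∀ S : Submodule ℂ[G] ℂ[G], IsSimpleModule ℂ[G] S → ∀ s ∈ S, a * s = 0 := by
    intro S hS s hs
    have hirr := isIrreducible_ofModule' (G := G) S
    have hfin : FiniteDimensional ℂ S := Module.Finite.trans (R := ℂ) ℂ[G] S
    have h0 := sum_smul_eq_zero_of_orthogonal hf horth (ofModule' (k := ℂ) (G := G) S)
    have h1 := congrArg Subtype.val (LinearMap.congr_fun h0 ⟨s, hs⟩)
    rw [LinearMap.sum_apply, Submodule.coe_sum] at h1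
    rw [ha, Finset.sum_mul]
    refine Eq.trans (Finset.sum_congr rfl fun g _ => ?_) h1
    have h2 : MonoidAlgebra.single g (f g) = f g • (MonoidAlgebra.single g (1 : ℂ)) := by simp
    rw [h2, smul_mul_assoc]
    rfl
  have hcentral : ∀ x : ℂ[G], a * x = x * a := by
    intro x
    induction x using MonoidAlgebra.induction_linear with
    | zero => simp
    | add x y hx hy => rw [mul_add, add_mul, hx, hy]
    | single h c =>
      rw [ha, Finset.sum_mul, Finset.mul_sum,
        ← (MulAut.conj h).toEquiv.sum_comp (fun g => MonoidAlgebra.single g (f g) * _)]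
      refine Finset.sum_congr rfl fun g _ => ?_
      change MonoidAlgebra.single (h * g * h⁻¹) (f (h * g * h⁻¹)) * _ = _
      rw [hf, MonoidAlgebra.single_mul_single, MonoidAlgebra.single_mul_single,
        inv_mul_cancel_right, mul_comm]
  let K : Submodule ℂ[G] ℂ[G] :=
    { carrier := {x | a * x = 0}
      add_mem' := fun {x y} hx hy => by
        change a * (x + y) = 0
        rw [mul_add, show a * x = 0 from hx, show a * y = 0 from hy, add_zero]
      zero_mem' := mul_zero a
      smul_mem' := fun r x hx => by
        change a * (r * x) = 0
        rw [← mul_assoc, hcentral, mul_assoc, show a * x = 0 from hx, mul_zero] }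
  have hK : (⊤ : Submodule ℂ[G] ℂ[G]) ≤ K := by
    have : NeZero (Nat.card G : ℂ) := ⟨Nat.cast_ne_zero.2 Nat.card_pos.ne'⟩
    rw [← IsSemisimpleModule.sSup_simples_eq_top ℂ[G] ℂ[G]]
    exact sSup_le fun S hS s hs => hact S hS s hs
  have ha0 : a = 0 := by
    have h1 : a * 1 = 0 := hK (Submodule.mem_top (x := (1 : ℂ[G])))
    rwa [mul_one] at h1
  ext g
  have h1 := congrArg (fun x : ℂ[G] => x.coeff g) ha0
  simpa [ha, Finsupp.single_apply] using h1

/-- Pairing class functions with `Irr G` is injective. This inequality suffices to turn the average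
class size into a bound in terms of `Irr G`. -/
theorem card_conjClasses_le_ncard_Irr : Nat.card (ConjClasses G) ≤ (Irr G).ncard := by
  classical
  have hfin : Finite (Irr G) := finite_Irr
  have := Fintype.ofFinite (Irr G)
  have := Fintype.ofFinite (ConjClasses G)
  let Φ : (ConjClasses G → ℂ) →ₗ[ℂ] (Irr G → ℂ) :=
    { toFun := fun φ χ => ∑ g, φ (ConjClasses.mk g) * (χ : G → ℂ) g
      map_add' := fun φ ψ => by
        ext χ
        simp [add_mul, Finset.sum_add_distrib]
      map_smul' := fun c φ => by
        ext χ
        simp [Finset.mul_sum, mul_assoc] }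
  have hinj : Function.Injective Φ := by
    rw [injective_iff_map_eq_zero]
    intro φ hφ
    have h0 := eq_zero_of_orthogonal_Irr (f := fun g => φ (ConjClasses.mk g))
      (fun g h => by
        congr 1
        exact ConjClasses.mk_eq_mk_iff_isConj.2 (isConj_iff.2 ⟨h⁻¹, by group⟩))
      (fun χ hχ => congrFun hφ ⟨χ, hχ⟩)
    ext c
    obtain ⟨g, rfl⟩ := ConjClasses.mk_surjective c
    exact congrFun h0 g
  have h1 := LinearMap.finrank_le_finrank_of_injective hinj
  rwa [Module.finrank_fintype_fun_eq_card, Module.finrank_fintype_fun_eq_card,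
    ← Nat.card_eq_fintype_card, ← Nat.card_eq_fintype_card, Nat.card_coe_set_eq] at h1

end Completeness

/-! ### Counting in rows and columns -/

section Proportions

variable {G : Type*} [Group G] [Finite G]

theorem half_lt_rowProportion (hG : Group.IsNilpotent G) {χ : G → ℂ} (hχ : χ ∈ Irr G) :
    1 / 2 < rowProportion χ := by
  obtain ⟨n, ρ, hρ, rfl⟩ := hχ
  have hpos : (0 : ℝ) < Nat.card G := Nat.cast_pos.2 Nat.card_pos
  rw [rowProportion, lt_div_iff₀ hpos]
  suffices h : Nat.card G < 2 * {g | IsRootOfUnityOrZero (ρ.character g)}.ncard by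
    have : (Nat.card G : ℝ) < 2 * ({g | IsRootOfUnityOrZero (ρ.character g)}.ncard : ℝ) := by
      exact_mod_cast h
    linarith
  by_cases hV : Module.finrank ℂ (Fin n → ℂ) = 1
  · have : {g | IsRootOfUnityOrZero (ρ.character g)} = Set.univ :=
      Set.eq_univ_of_forall fun g =>
        Or.inl ⟨Nat.card G, Nat.card_pos, ρ.character_pow_card_eq_one hV g⟩
    rw [this, Set.ncard_univ]
    have := Nat.card_pos (α := G)
    lia
  · have h1 := ρ.two_mul_ncard_support_lt hG hV
    have h2 := Set.ncard_add_ncard_compl {g | ρ.character g ≠ 0}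
    have h3 : {g | ρ.character g ≠ 0}ᶜ.ncard ≤
        {g | IsRootOfUnityOrZero (ρ.character g)}.ncard :=
      Set.ncard_le_ncard (fun g hg => Or.inr (not_not.1 hg)) (Set.toFinite _)
    lia

/-- The `m`-th power map is injective on `G` and respects conjugacy. -/
theorem ncard_conjugatesOf_le_pow (g : G) {m : ℕ} (hm : (Nat.card G).Coprime m) :
    (conjugatesOf g).ncard ≤ (conjugatesOf (g ^ m)).ncard := by
  refine Set.ncard_le_ncard_of_injOn (fun h => h ^ m) (fun h hh => ?_)
    (fun a _ b _ hab => (powCoprime hm).injective hab) (Set.toFinite _)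
  obtain ⟨c, rfl⟩ := isConj_iff.1 hh
  exact isConj_iff.2 ⟨c, (conj_pow (i := m)).symm⟩

theorem half_lt_columnProportion (hG : Group.IsNilpotent G) {g : G}
    (hg : HasAtLeastAverageClass g) : 1 / 2 < columnProportion g := by
  classical
  have hfin := finite_Irr (G := G)
  have := Fintype.ofFinite G
  have : Fintype (Irr G) := hfin.fintype
  set U := unitExponents (Nat.card G)
  have hφ : 0 < (Nat.card G).totient := Nat.totient_pos.2 Nat.card_pos
  have hIrr : (Irr G).ncard = Fintype.card (Irr G) := by
    rw [← Nat.card_eq_fintype_card, Nat.card_coe_set_eq]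
  have hIrrpos : 0 < Fintype.card (Irr G) := Fintype.card_pos_iff.2 ⟨⟨1, one_mem_Irr G⟩⟩
  have hclass : (Nat.card G : ℝ) ≤ Fintype.card (Irr G) * (conjugatesOf g).ncard := by
    have h1 : (0 : ℝ) < Nat.card (ConjClasses G) := Nat.cast_pos.2 Nat.card_pos
    have h2 : (Nat.card (ConjClasses G) : ℝ) ≤ Fintype.card (Irr G) := by
      rw [← hIrr]
      exact_mod_cast card_conjClasses_le_ncard_Irr (G := G)
    rw [HasAtLeastAverageClass, div_le_iff₀ h1, mul_comm] at hg
    exact hg.trans (mul_le_mul_of_nonneg_right h2 (Nat.cast_nonneg _))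
  have hcol : ∀ m ∈ U, ∑ χ : Irr G, ‖(χ : G → ℂ) (g ^ m)‖ ^ 2 ≤ Fintype.card (Irr G) := by
    intro m hm
    have h1 := ncard_conjugatesOf_mul_sum_norm_sq_le (g ^ m) Finset.univ
    have h2 := ncard_conjugatesOf_le_pow g (Finset.mem_filter.1 hm).2
    have h3 : (0 : ℝ) < (conjugatesOf (g ^ m)).ncard :=
      Nat.cast_pos.2 ((Set.ncard_pos (Set.toFinite _)).2 ⟨g ^ m, IsConj.refl _⟩)
    have h4 : (Fintype.card (Irr G) : ℝ) * (conjugatesOf g).ncard ≤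
        Fintype.card (Irr G) * (conjugatesOf (g ^ m)).ncard :=
      mul_le_mul_of_nonneg_left (Nat.cast_le.2 h2) (Nat.cast_nonneg _)
    refine le_of_mul_le_mul_left ?_ h3
    rw [mul_comm _ (Fintype.card (Irr G) : ℝ)]
    exact h1.trans (hclass.trans h4)
  set w : Irr G → ℝ := fun χ => ∑ m ∈ U, ‖(χ : G → ℂ) (g ^ m)‖ ^ 2 with hw
  have hwsum : ∑ χ, w χ ≤ (Nat.card G).totient * Fintype.card (Irr G) := by
    rw [hw, Finset.sum_comm]
    calc _ ≤ ∑ m ∈ U, (Fintype.card (Irr G) : ℝ) := Finset.sum_le_sum hcol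
      _ = _ := by rw [Finset.sum_const, nsmul_eq_mul]; rfl
  set bad : Finset (Irr G) := {χ | ¬ IsRootOfUnityOrZero ((χ : G → ℂ) g)} with hbad
  have hwbad : ∀ χ ∈ bad, 2 * ((Nat.card G).totient : ℝ) ≤ w χ := by
    rintro ⟨_, n, ρ, hρ, rfl⟩ hχ
    have hχ' : ¬ IsRootOfUnityOrZero (ρ.character g) := (Finset.mem_filter.1 hχ).2
    refine ρ.two_mul_totient_le_sum_norm_character_sq hG (fun hV => hχ' ?_) fun h0 => hχ' (Or.inr h0)
    exact Or.inl ⟨Nat.card G, Nat.card_pos, ρ.character_pow_card_eq_one hV g⟩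
  -- The trivial character supplies the extra 1 that makes the final inequality strict.
  let χ₁ : Irr G := ⟨1, one_mem_Irr G⟩
  have hw1 : w χ₁ = (Nat.card G).totient := by
    simp only [hw, χ₁, Pi.one_apply, norm_one, one_pow, Finset.sum_const, nsmul_eq_mul, mul_one]
    rfl
  have h1bad : χ₁ ∉ bad := by
    intro h
    exact (Finset.mem_filter.1 h).2 (Or.inl ⟨1, one_pos, by simp [χ₁]⟩)
  have hcount : 2 * bad.card + 1 ≤ Fintype.card (Irr G) := by
    have h1 : ∑ χ ∈ insert χ₁ bad, w χ ≤ ∑ χ, w χ :=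
      Finset.sum_le_sum_of_subset_of_nonneg (Finset.subset_univ _) fun χ _ _ =>
        Finset.sum_nonneg fun m _ => by positivity
    rw [Finset.sum_insert h1bad, hw1] at h1
    have h2 := Finset.card_nsmul_le_sum _ _ _ hwbad
    rw [nsmul_eq_mul] at h2
    have h3 : ((Nat.card G).totient : ℝ) * (2 * bad.card + 1) ≤
        (Nat.card G).totient * Fintype.card (Irr G) := by linarith
    have h4 := le_of_mul_le_mul_left h3 (Nat.cast_pos.2 hφ)
    exact_mod_cast h4
  have hgood : {χ : G → ℂ | χ ∈ Irr G ∧ IsRootOfUnityOrZero (χ g)}.ncard + bad.card =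
      Fintype.card (Irr G) := by
    have h1 : {χ : G → ℂ | χ ∈ Irr G ∧ IsRootOfUnityOrZero (χ g)} =
        Subtype.val '' ((badᶜ : Finset (Irr G)) : Set (Irr G)) := by
      ext χ
      simp [hbad, and_comm]
    rw [h1, Set.ncard_image_of_injective _ Subtype.val_injective, Set.ncard_coe_finset,
      Finset.card_compl, Nat.sub_add_cancel (Finset.card_le_univ _)]
  rw [columnProportion, lt_div_iff₀ (by rw [hIrr]; exact_mod_cast hIrrpos), hIrr]
  have h5 : (2 * bad.card + 1 : ℝ) ≤ Fintype.card (Irr G) := by exact_mod_cast hcount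
  have h6 : ({χ : G → ℂ | χ ∈ Irr G ∧ IsRootOfUnityOrZero (χ g)}.ncard : ℝ) + bad.card =
      Fintype.card (Irr G) := by exact_mod_cast hgood
  linarith

theorem exists_hasAtLeastAverageClass : ∃ g : G, HasAtLeastAverageClass g := by
  classical
  have := Fintype.ofFinite G
  have hpos : (0 : ℝ) < Nat.card (ConjClasses G) := Nat.cast_pos.2 Nat.card_pos
  by_contra! hc
  have hlt : ∀ c : ConjClasses G, (c.carrier.toFinset.card : ℝ) <
      (Nat.card G : ℝ) / Nat.card (ConjClasses G) := by
    intro c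
    obtain ⟨g, rfl⟩ := ConjClasses.mk_surjective c
    have := not_le.1 (hc g)
    rwa [Set.ncard_eq_toFinset_card' (conjugatesOf g)] at this
  have h1 := sum_conjClasses_card_eq_card G
  have h2 : ∑ c : ConjClasses G, (c.carrier.toFinset.card : ℝ) <
      ∑ c : ConjClasses G, (Nat.card G : ℝ) / Nat.card (ConjClasses G) :=
    Finset.sum_lt_sum_of_nonempty ⟨ConjClasses.mk 1, Finset.mem_univ _⟩ fun c _ => hlt c
  rw [← Nat.cast_sum, h1, Finset.sum_const, Finset.card_univ, nsmul_eq_mul,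
    ← Nat.card_eq_fintype_card, ← Nat.card_eq_fintype_card, mul_div_cancel₀ _ hpos.ne'] at h2
  exact lt_irrefl _ h2

theorem isLeast_sInf_of_finite {s : Set ℝ} (hs : s.Finite) (hne : s.Nonempty) :
    IsLeast s (sInf s) :=
  ⟨hne.csInf_mem hs, fun _ hr => csInf_le hs.bddBelow hr⟩

end Proportions

theorem theorem3 {G : Type*} [Group G] [Finite G] (hG : Group.IsNilpotent G) :
    (IsLeast (rowProportions G) (theta G) ∧ 1 / 2 < theta G) ∧
      (IsLeast (columnProportions G) (theta' G) ∧ 1 / 2 < theta' G) := by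
  have hrow : IsLeast (rowProportions G) (theta G) :=
    isLeast_sInf_of_finite (finite_Irr.image rowProportion) ⟨_, 1, one_mem_Irr G, rfl⟩
  have hcol : IsLeast (columnProportions G) (theta' G) := by
    -- Nonemptiness matters: the real `sInf` of the empty set is 0.
    obtain ⟨g, hg⟩ := exists_hasAtLeastAverageClass (G := G)
    exact isLeast_sInf_of_finite ((Set.toFinite {g : G | HasAtLeastAverageClass g}).image
      columnProportion) ⟨_, g, hg, rfl⟩
  obtain ⟨χ, hχ, hr⟩ := hrow.1
  obtain ⟨g, hg, hc⟩ := hcol.1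
  exact ⟨⟨hrow, hr ▸ half_lt_rowProportion hG hχ⟩, hcol, hc ▸ half_lt_columnProportion hG hg⟩
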